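/- Let $n\ge 2$ be an integer. A function $\psi\in C^\infty([0,+\infty))$ is called a \emph{model function} if $\psi>0$ on $(0,+\infty)$, $\psi(0)=0$, $\psi'(0)=1$ and $\psi^{(2k)}(0)=0$ for every $k\in\mathbb{N}$. The associated model manifold $\mathbb{M}^n$ is $\mathbb{R}^n$ endowed with the smooth Riemannian metric which, in polar coordinates $(r,\theta)\in(0,+\infty)\times\mathbb{S}^{n-1}$ about the pole $o=0$, is $$\mathsf{g}=dr^2+\psi(r)^2\,\mathsf{g}_{\mathbb{S}^{n-1}} .$$ It is \emph{Cartan--Hadamard} if it is complete, simply connected and has everywhere nonpositive sectional curvatures. Let $\Delta$ be its Laplace--Beltrami operator and $dV$ its Riemannian volume measure. A function is \emph{radial} if it depends only on the distance $r$ from $o$. Let $D^{1,2}_{\mathrm{rad}}(\mathbb{M}^n)$ be the closure of the radial functions in $C^1_c(\mathbb{M}^n)$ with respect to the norm $\|\nabla f\|_{L^2}=\left(\int_{\mathbb{M}^n}|\nabla f|^2\,dV\right)^{1/2}$; a radial $C^1$ function $u$ belongs to it if there are radial $\varphi_k\in C^1_c(\mathbb{M}^n)$ with $\|\nabla(\varphi_k-u)\|_{L^2}\to0$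 and $\varphi_k\to u$ almost everywhere. For $\alpha>1$ set $$\tilde 2_\alpha=\frac{\alpha(n-1)+1}{\alpha(n-1)-1},\qquad 2^*_\alpha=\frac{2(\alpha(n-1)+1)}{\alpha(n-1)-1}.$$ \textbf{Theorem.} For every $n\ge2$, every $\alpha>1$ and every $q\in\left(\tilde 2_\alpha,\,2^*_\alpha-1\right)$ there exist a model function $\psi$ and a constant $\kappa>0$ such that $$\lim_{r\to+\infty}\frac{\psi'(r)}{\kappa\,\alpha\,r^{\alpha-1}}=1,$$ the model manifold $\mathbb{M}^n$ associated with $\psi$ is Cartan--Hadamard, and the Lane--Emden equation $$-\Delta u=u^q,\qquad u>0\qquad\text{on }\mathbb{M}^n$$ has a (classical, $C^2$) radial solution $u\in D^{1,2}_{\mathrm{rad}}(\mathbb{M}^n)$. -/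

import Mathlib

open Set Filter Topology MeasureTheory Manifold Asymptotics
open scoped ContDiff ENNReal

noncomputable section

namespace LaneEmden

/-- The exponent `(α (n - 1) + 1) / (α (n - 1) - 1)`. -/
def tildeTwo (n : ℕ) (α : ℝ) : ℝ := (α * ((n : ℝ) - 1) + 1) / (α * ((n : ℝ) - 1) - 1)

/-- The exponent `2 (α (n - 1) + 1) / (α (n - 1) - 1)`. -/
def twoStar (n : ℕ) (α : ℝ) : ℝ := 2 * (α * ((n : ℝ) - 1) + 1) / (α * ((n : ℝ) - 1) - 1)

/-- Model functions `ψ : [0, ∞) → [0, ∞)`: smooth up to the boundary point `0`, positive on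
`(0, ∞)`, with `ψ(0) = 0`, `ψ'(0) = 1` and `ψ^(2k)(0) = 0` for every `k`. Only the values of `ψ`
on `[0, ∞)` matter; derivatives at `0` are one-sided. -/
structure IsModelFunction (ψ : ℝ → ℝ) : Prop where
  smooth : ContDiffOn ℝ ∞ ψ (Ici 0)
  pos : ∀ r : ℝ, 0 < r → 0 < ψ r
  map_zero : ψ 0 = 0
  deriv_zero : derivWithin ψ (Ici 0) 0 = 1
  even_deriv_zero : ∀ k : ℕ, iteratedDerivWithin (2 * k) ψ (Ici 0) 0 = 0

section Metric

variable {E : Type} [NormedAddCommGroup E] [NormedSpace ℝ E]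

/-- Smooth (`C^∞`) Riemannian metrics on a finite-dimensional space `E`, seen as a manifold. -/
abbrev SmoothMetric (E : Type) [NormedAddCommGroup E] [NormedSpace ℝ E] : Type :=
  Bundle.ContMDiffRiemannianMetric 𝓘(ℝ, E) ∞ E (fun x : E => TangentSpace 𝓘(ℝ, E) x)

/-- The metric read in the global chart: a field of bilinear forms on `E`. -/
def form (g : SmoothMetric E) (x : E) : E →L[ℝ] E →L[ℝ] ℝ := g.inner x

/-- Smoothness of a section of bilinear forms on the tangent bundle is smoothness in the global
chart. -/
theorem contMDiffAt_section_iff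
    (G : (x : E) → TangentSpace 𝓘(ℝ, E) x →L[ℝ] TangentSpace 𝓘(ℝ, E) x →L[ℝ] ℝ)
    (G' : E → E →L[ℝ] E →L[ℝ] ℝ) (h : ∀ x, G x = G' x) (x : E) :
    ContMDiffAt 𝓘(ℝ, E) (𝓘(ℝ, E).prod 𝓘(ℝ, E →L[ℝ] E →L[ℝ] ℝ)) ∞
      (fun b => Bundle.TotalSpace.mk' (E →L[ℝ] E →L[ℝ] ℝ) b (G b)) x ↔ ContDiffAt ℝ ∞ G' x := by
  refine (Bundle.contMDiffAt_section _).trans (Iff.trans ?_ contMDiffAt_iff_contDiffAt)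
  refine Iff.of_eq
    (congrArg (fun f => ContMDiffAt 𝓘(ℝ, E) 𝓘(ℝ, E →L[ℝ] E →L[ℝ] ℝ) ∞ f x) ?_)
  funext y
  rw [← h]
  refine ContinuousLinearMap.ext fun v => ContinuousLinearMap.ext fun w => ?_
  simp only [hom_trivializationAt_apply]
  unfold ContinuousLinearMap.inCoordinates
  simp
  rw [Bundle.Trivialization.linearMapAt_apply, if_pos (by simp; exact mem_univ y)]
  simp only [hom_trivializationAt_apply]
  unfold ContinuousLinearMap.inCoordinates
  simp
  rfl

/-- The coefficients of a smooth metric are smooth in the global chart. -/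
theorem contDiff_form (g : SmoothMetric E) : ContDiff ℝ ∞ (form g) :=
  contDiff_iff_contDiffAt.2 fun x =>
    (contMDiffAt_section_iff g.inner (form g) (fun _ => rfl) x).1 (g.contMDiff x)

/-- The Riemannian distance of `g`: the infimum of the `g`-lengths of `C¹` curves. -/
def riemDist (g : SmoothMetric E) (x y : E) : ℝ≥0∞ :=
  letI : ∀ z : E, ENorm (TangentSpace 𝓘(ℝ, E) z) :=
    fun z => ⟨fun v => ENNReal.ofReal (Real.sqrt (g.inner z v v))⟩
  riemannianEDist 𝓘(ℝ, E) x y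

/-- Completeness of the metric space `(E, riemDist g)`. -/
def IsCompleteMetric (g : SmoothMetric E) : Prop :=
  ∀ s : ℕ → E,
    (∀ ε : ℝ≥0∞, 0 < ε → ∃ N : ℕ, ∀ i j : ℕ, N ≤ i → N ≤ j → riemDist g (s i) (s j) < ε) →
      ∃ x : E, Tendsto (fun i => riemDist g (s i) x) atTop (𝓝 0)

/-- The Christoffel symbols `Γ(v, w)` of the Levi-Civita connection: raise the index of the
covector `z ↦ ½ (∂_v g(w, z) + ∂_w g(v, z) - ∂_z g(v, w))`. -/
def christoffel (g : SmoothMetric E) (x v w : E) : E :=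
  let D : E →L[ℝ] E →L[ℝ] E →L[ℝ] ℝ := fderiv ℝ (form g) x
  (form g x).inverse ((1 / 2 : ℝ) • (D v w + D w v - (D.flip v).flip w))

/-- The Riemann curvature tensor `R(v, w) z = ∇_v ∇_w z - ∇_w ∇_v z`, for constant vector fields
`v`, `w`, `z`, so that `∇_v z = Γ(v, z)`. -/
def riemann (g : SmoothMetric E) (x v w z : E) : E :=
  fderiv ℝ (fun y => christoffel g y w z) x v - fderiv ℝ (fun y => christoffel g y v z) x w
    + christoffel g x v (christoffel g x w z) - christoffel g x w (christoffel g x v z)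

/-- The sectional curvature of the plane spanned by `v` and `w` at `x`. -/
def sectionalCurvature (g : SmoothMetric E) (x v w : E) : ℝ :=
  form g x (riemann g x v w w) v
    / (form g x v v * form g x w w - form g x v w ^ 2)

/-- Cartan–Hadamard: simply connected, complete, all sectional curvatures nonpositive. -/
structure IsCartanHadamard (g : SmoothMetric E) : Prop where
  simplyConnected : SimplyConnectedSpace E
  complete : IsCompleteMetric g
  curvature_nonpos : ∀ x v w : E, LinearIndependent ℝ ![v, w] →
    sectionalCurvature g x v w ≤ 0

/-- The Riemannian gradient: the vector `∇u` with `g(∇u, ·) = du`. -/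
def grad (g : SmoothMetric E) (u : E → ℝ) (x : E) : E :=
  (form g x).inverse (fderiv ℝ u x)

end Metric

/-- The underlying manifold `ℝⁿ`; its origin is the pole. -/
abbrev Space (n : ℕ) : Type := EuclideanSpace ℝ (Fin n)

/-- Smooth Riemannian metrics on the manifold `ℝⁿ`. -/
abbrev Metric (n : ℕ) : Type := SmoothMetric (Space n)

variable {n : ℕ}

/-- In polar coordinates `(r, θ) ↦ r θ`, `r > 0`, `|θ| = 1`, the metric is
`dr² + ψ(r)² g_{S^{n-1}}`. A tangent vector `(a, ξ)`, `ξ ⊥ θ`, at `(r, θ)` is mapped to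
`a θ + r ξ` by the differential of the polar coordinates. -/
def IsModelMetric (g : Metric n) (ψ : ℝ → ℝ) : Prop :=
  ∀ (r : ℝ) (θ : Space n) (a b : ℝ) (ξ η : Space n), 0 < r → ‖θ‖ = 1 →
    inner ℝ θ ξ = 0 → inner ℝ θ η = 0 →
      form g (r • θ) (a • θ + r • ξ) (b • θ + r • η) = a * b + ψ r ^ 2 * inner ℝ ξ η

/-- The Riemannian volume density `√(det (g_ij))`. -/
def volDensity (g : Metric n) (x : Space n) : ℝ :=
  Real.sqrt (Matrix.of fun i j : Fin n =>
    form g x (EuclideanSpace.single i 1) (EuclideanSpace.single j 1)).det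

/-- The Riemannian volume measure `dV = √(det (g_ij)) dx`. -/
def riemVolume (g : Metric n) : Measure (Space n) :=
  (volume : Measure (Space n)).withDensity fun x => ENNReal.ofReal (volDensity g x)

/-- The Laplace–Beltrami operator `Δu = (√det g)⁻¹ ∑ᵢ ∂ᵢ (√det g (∇u)ⁱ)`. -/
def laplaceBeltrami (g : Metric n) (u : Space n → ℝ) (x : Space n) : ℝ :=
  (volDensity g x)⁻¹ *
    ∑ i : Fin n, fderiv ℝ (fun y => volDensity g y * grad g u y i) x (EuclideanSpace.single i 1)

/-- A function on `ℝⁿ` that depends only on the distance from the pole (which is `|x|` for a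
metric in polar form). -/
def IsRadial (u : Space n → ℝ) : Prop := ∃ U : ℝ → ℝ, ∀ x : Space n, u x = U ‖x‖

/-- Classical positive solutions of the Lane–Emden equation `-Δu = u^q`. -/
structure IsLaneEmdenSolution (g : Metric n) (q : ℝ) (u : Space n → ℝ) : Prop where
  contDiff : ContDiff ℝ 2 u
  pos : ∀ x : Space n, 0 < u x
  eqn : ∀ x : Space n, -laplaceBeltrami g u x = u x ^ q

/-- The squared energy norm `∫ |∇f|² dV`. -/
def energy (g : Metric n) (f : Space n → ℝ) : ℝ≥0∞ :=
  ∫⁻ x, ENNReal.ofReal (form g x (grad g f x) (grad g f x)) ∂(riemVolume g)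

/-- The `C¹` radial function `u` belongs to `D^{1,2}_rad`, the closure of the compactly supported
radial `C¹` functions in the norm `‖∇f‖_{L²}`. The almost everywhere convergence identifies `u`
itself, not merely its gradient, as the limit of the approximating sequence. -/
def MemD12Rad (g : Metric n) (u : Space n → ℝ) : Prop :=
  ContDiff ℝ 1 u ∧ IsRadial u ∧
    ∃ φ : ℕ → Space n → ℝ,
      (∀ k, ContDiff ℝ 1 (φ k) ∧ HasCompactSupport (φ k) ∧ IsRadial (φ k)) ∧
      Tendsto (fun k => energy g (fun x => φ k x - u x)) atTop (𝓝 0) ∧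
      ∀ᵐ x ∂(riemVolume g), Tendsto (fun k => φ k x) atTop (𝓝 (u x))

end LaneEmden

end

noncomputable section

set_option maxSynthPendingDepth 3

namespace LaneEmden

/-! ### Smoothness of difference quotients -/

/-! The equation is solved backwards: the solution is prescribed and the metric is read off from it.
With t = |x|², take the metric a(t)⟨v,w⟩ + b(t)⟨x,v⟩⟨x,w⟩, where a = e^Λ and a + tb = 1, so that
ψ(r) = r e^{Λ(r²)/2}. For u = U(t) the Laplacian is 4tU'' + (2n + 2(n-1)tΛ')U'
(`laplaceBeltrami_radial`). This is affine in Λ', so a positive decreasing U determines Λ'. What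
remains is to choose U so that Λ' is smooth at 0, has the right growth and gives nonpositive
curvature.

The model case is the Aubin–Talenti bubble U = c(1+t)^{-2/(q-1)}, for which Λ' is a constant
multiple of 1/(1+t). It makes q critical for a growth exponent α' > α, where 4/(q-1) = α'(n-1) - 1.
The bubble is therefore bent: U'/U = -k/((q-1)(1+t)), with k decreasing slowly from near 2 to 1+s,
where 2(1+s)/(q-1) = α(n-1) - 1. The two bounds on q say exactly that 0 < s < 1. The equation
becomes (n-1)(1+t)Λ' = nD + H (`hasDerivAt_Λ`, `ode`), where D = (V-1)/t is O((1+t)^{-s}) and H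
tends to (n-1)(α-1). Integrating gives the asymptotics of ψ'.

Nonpositive curvature follows from Λ' ≥ 0 and 3Λ' + 2tΛ'' ≥ 0 (`sectionalCurvature_metric_nonpos`).
The second inequality is `convexity`: a small ε keeps D small and a small σ makes H vary slowly. The
energy density has an integrable power bound (`energy_bound`), and truncating the values of u puts
it in the energy space (`memD12Rad`). -/

theorem hasDerivAt_integral_pow_mul_comp {f : ℝ → ℝ} (hf : ContDiff ℝ 1 f) (k : ℕ) (t : ℝ) :
    HasDerivAt (fun t => ∫ τ in (0 : ℝ)..1, τ ^ k * f (τ * t))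
      (∫ τ in (0 : ℝ)..1, τ ^ (k + 1) * deriv f (τ * t)) t := by
  have hf' : Continuous (deriv f) := hf.continuous_deriv le_rfl
  have hc : Continuous f := hf.continuous
  obtain ⟨C, hC⟩ := (isCompact_Icc (a := -(|t| + 1)) (b := |t| + 1)).exists_bound_of_continuousOn
    hf'.continuousOn
  refine (intervalIntegral.hasDerivAt_integral_of_dominated_loc_of_deriv_le
    (F := fun t τ => τ ^ k * f (τ * t)) (F' := fun t τ => τ ^ (k + 1) * deriv f (τ * t))
    (bound := fun _ => C) (Metric.ball_mem_nhds t one_pos) ?_ ?_ ?_ ?_ ?_ ?_).2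
  · exact Eventually.of_forall fun x => Continuous.aestronglyMeasurable (by fun_prop)
  · exact Continuous.intervalIntegrable (by fun_prop) _ _
  · exact Continuous.aestronglyMeasurable (by fun_prop)
  · refine Eventually.of_forall fun τ hτ x hx => ?_
    rw [uIoc_of_le zero_le_one] at hτ
    rw [Metric.mem_ball, Real.dist_eq] at hx
    have hx' : |x| ≤ |t| + 1 := by
      have := abs_sub_abs_le_abs_sub x t
      linarith
    have h1 : |τ * x| ≤ |t| + 1 := by
      rw [abs_mul, abs_of_pos hτ.1]
      nlinarith [abs_nonneg x, hτ.2]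
    have h2 := hC (τ * x) (abs_le.1 h1)
    rw [norm_mul, norm_pow, Real.norm_of_nonneg hτ.1.le]
    calc τ ^ (k + 1) * ‖deriv f (τ * x)‖ ≤ 1 * ‖deriv f (τ * x)‖ := by
          gcongr
          exact pow_le_one₀ hτ.1.le hτ.2
      _ ≤ C := by rwa [one_mul]
  · exact intervalIntegrable_const
  · refine Eventually.of_forall fun τ _ x _ => ?_
    have h1 : HasDerivAt (fun x => τ * x) τ x := by simpa using (hasDerivAt_id x).const_mul τ
    have h2 := ((hf.differentiable one_ne_zero (τ * x)).hasDerivAt.comp x h1).const_mul (τ ^ k)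
    exact h2.congr_deriv (by ring)

/-- Each derivative under the integral raises the power of τ by one, so the induction must run over
all k at once. -/
theorem contDiff_integral_pow_mul_comp (m : ℕ) : ∀ (k : ℕ) {f : ℝ → ℝ}, ContDiff ℝ ∞ f →
    ContDiff ℝ m (fun t => ∫ τ in (0 : ℝ)..1, τ ^ k * f (τ * t)) := by
  induction m with
  | zero =>
    intro k f hf
    refine contDiff_zero.2 (continuous_iff_continuousAt.2 fun t => ?_)
    exact (hasDerivAt_integral_pow_mul_comp (hf.of_le (by simp)) k t).continuousAt
  | succ m ih =>
    intro k f hf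
    have h := hasDerivAt_integral_pow_mul_comp (hf.of_le (by simp)) k
    rw [Nat.cast_succ, contDiff_succ_iff_deriv]
    refine ⟨fun t => (h t).differentiableAt, by simp, ?_⟩
    rw [funext fun t => (h t).deriv]
    exact ih (k + 1) (contDiff_infty_iff_deriv.1 hf).2

theorem dslope_zero_eq_integral {f : ℝ → ℝ} (hf : ContDiff ℝ 1 f) (t : ℝ) :
    dslope f 0 t = ∫ τ in (0 : ℝ)..1, deriv f (τ * t) := by
  rcases eq_or_ne t 0 with rfl | ht
  · simp
  · rw [dslope_of_ne _ ht, slope_def_field, sub_zero, intervalIntegral.integral_comp_mul_right _ ht,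
      zero_mul, one_mul, intervalIntegral.integral_deriv_eq_sub
        (fun x _ => hf.differentiable one_ne_zero x)
        ((hf.continuous_deriv le_rfl).intervalIntegrable _ _), smul_eq_mul, inv_mul_eq_div]

/-- Hadamard's lemma: (f(t) - f(0))/t is the mean of f' over the segment from 0 to t. It gives
smoothness at the pole for both b and D. -/
theorem contDiff_dslope_zero {f : ℝ → ℝ} (hf : ContDiff ℝ ∞ f) : ContDiff ℝ ∞ (dslope f 0) := by
  rw [funext (dslope_zero_eq_integral (hf.of_le (by simp))), contDiff_infty]
  intro m
  simpa using contDiff_integral_pow_mul_comp m 0 (contDiff_infty_iff_deriv.1 hf).2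

/-! ### Radial metrics on an inner product space -/

/-- Logarithms `Λ` of the factors by which radial metrics stretch the tangential directions, as
functions of the squared Euclidean distance to the pole. -/
structure Profile where
  /-- The logarithm of the tangential factor. -/
  toFun : ℝ → ℝ
  smooth : ContDiff ℝ ∞ toFun
  map_zero : toFun 0 = 0
  nonneg : ∀ t, 0 ≤ t → 0 ≤ toFun t

namespace Profile

variable (p : Profile)

/-- The tangential factor. -/
def a (t : ℝ) : ℝ := Real.exp (p.toFun t)

/-- The coefficient of the rank one part of a radial metric. -/
def b (t : ℝ) : ℝ := -dslope p.a 0 t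

theorem contDiff_a : ContDiff ℝ ∞ p.a := Real.contDiff_exp.comp p.smooth

theorem contDiff_b : ContDiff ℝ ∞ p.b := (contDiff_dslope_zero p.contDiff_a).neg

theorem a_pos (t : ℝ) : 0 < p.a t := Real.exp_pos _

theorem one_le_a {t : ℝ} (ht : 0 ≤ t) : 1 ≤ p.a t := Real.one_le_exp (p.nonneg t ht)

/-- Since b is (1 - a)/t, the form pairs x with any v as ⟨x, v⟩: radial directions keep their
Euclidean length. Most later simplifications come from this. -/
theorem a_add (t : ℝ) : p.a t + t * p.b t = 1 := by
  have h := sub_smul_dslope p.a 0 t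
  have h0 : p.a 0 = 1 := by simp [a, p.map_zero]
  rw [h0, smul_eq_mul, sub_zero] at h
  rw [b]
  linarith

theorem hasDerivAt_a (t : ℝ) : HasDerivAt p.a (p.a t * deriv p.toFun t) t :=
  ((p.smooth.differentiable (by simp)) t).hasDerivAt.exp

theorem deriv_a (t : ℝ) : deriv p.a t = p.a t * deriv p.toFun t := (p.hasDerivAt_a t).deriv

theorem hasDerivAt_b (t : ℝ) : HasDerivAt p.b (deriv p.b t) t :=
  ((p.contDiff_b.differentiable (by simp)) t).hasDerivAt

theorem deriv_b (t : ℝ) : deriv p.a t + p.b t + t * deriv p.b t = 0 := by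
  have h := (p.hasDerivAt_a t).add ((hasDerivAt_id t).mul (p.hasDerivAt_b t))
  have h1 : (p.a + id * p.b) = fun _ => (1 : ℝ) := funext p.a_add
  rw [h1] at h
  have := h.unique (hasDerivAt_const t 1)
  simp only [id_eq] at this
  rw [p.deriv_a]
  linarith

variable {E : Type} [NormedAddCommGroup E] [InnerProductSpace ℝ E]

/-- The Euclidean inner product as a bilinear form. -/
def euclid (E : Type) [NormedAddCommGroup E] [InnerProductSpace ℝ E] : E →L[ℝ] E →L[ℝ] ℝ :=
  innerSL ℝ

theorem euclid_apply (v w : E) : euclid E v w = inner ℝ v w := rfl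

/-- The bilinear forms `a ⟪v, w⟫ + b ⟪x, v⟫ ⟪x, w⟫`. -/
def bilin (x : E) : E →L[ℝ] E →L[ℝ] ℝ :=
  p.a (‖x‖ ^ 2) • euclid E +
    p.b (‖x‖ ^ 2) • (euclid E x).smulRight (euclid E x)

theorem bilin_apply (x v w : E) : p.bilin x v w =
    p.a (‖x‖ ^ 2) * inner ℝ v w + p.b (‖x‖ ^ 2) * (inner ℝ x v * inner ℝ x w) := by
  simp [bilin, euclid_apply]

theorem bilin_comm (x v w : E) : p.bilin x v w = p.bilin x w v := by
  rw [bilin_apply, bilin_apply, real_inner_comm, mul_comm (inner ℝ x v)]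

theorem contDiff_bilin : ContDiff ℝ ∞ (p.bilin (E := E)) := by
  have h1 := p.contDiff_a.comp (contDiff_norm_sq ℝ (E := E) (n := ∞))
  have h2 := p.contDiff_b.comp (contDiff_norm_sq ℝ (E := E) (n := ∞))
  have h3 : ContDiff ℝ ∞ (fun x : E => euclid E x) := (euclid E).contDiff
  exact (h1.smul contDiff_const).add (h2.smul (h3.smulRight h3))

/-- Multiplied by t = |x|², the difference of the two sides is (a - 1)(t|v|² - ⟨x,v⟩²). This bound
yields definiteness and completeness. -/
theorem norm_sq_le_bilin (x v : E) : ‖v‖ ^ 2 ≤ p.bilin x v v := by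
  rw [bilin_apply, real_inner_self_eq_norm_sq]
  have h1 := p.one_le_a (sq_nonneg ‖x‖)
  have h2 := p.a_add (‖x‖ ^ 2)
  rcases eq_or_ne x 0 with rfl | hx
  · simp only [inner_zero_left, mul_zero, add_zero]
    nlinarith [sq_nonneg ‖v‖]
  · have ht : 0 < ‖x‖ ^ 2 := by positivity
    have h3 : inner ℝ x v * inner ℝ x v ≤ ‖x‖ ^ 2 * ‖v‖ ^ 2 := by
      have := real_inner_mul_inner_self_le x v
      rwa [real_inner_self_eq_norm_sq, real_inner_self_eq_norm_sq] at this
    refine le_of_mul_le_mul_left ?_ ht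
    have h4 : p.b (‖x‖ ^ 2) * ‖x‖ ^ 2 = 1 - p.a (‖x‖ ^ 2) := by linarith
    nlinarith [mul_nonneg (sub_nonneg.2 h1) (sub_nonneg.2 h3)]

theorem bilin_pos (x : E) {v : E} (hv : v ≠ 0) : 0 < p.bilin x v v := by
  have h1 : 0 < ‖v‖ := norm_pos_iff.2 hv
  exact lt_of_lt_of_le (by positivity) (p.norm_sq_le_bilin x v)

theorem isVonNBounded_bilin (x : E) : Bornology.IsVonNBounded ℝ {v : E | p.bilin x v v < 1} := by
  refine (NormedSpace.isVonNBounded_ball ℝ E 1).subset fun v hv => ?_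
  rw [mem_ball_zero_iff]
  exact (sq_lt_one_iff₀ (norm_nonneg _)).1 ((p.norm_sq_le_bilin x v).trans_lt hv)

/-- The radial metric with a given profile. -/
def metric : SmoothMetric E where
  inner x := p.bilin (E := E) x
  symm x v w := p.bilin_comm (E := E) x v w
  pos x v hv := @bilin_pos p E _ _ x v hv
  isVonNBounded x := p.isVonNBounded_bilin (E := E) x
  contMDiff x := (contMDiffAt_section_iff _ p.bilin (fun _ => rfl) x).2
    p.contDiff_bilin.contDiffAt

theorem form_metric : form (p.metric (E := E)) = p.bilin := rfl

theorem isInvertible_bilin [FiniteDimensional ℝ E] (x : E) : (p.bilin x).IsInvertible := by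
  have hinj : Function.Injective (p.bilin x) := by
    refine (injective_iff_map_eq_zero _).2 fun v hv => ?_
    have h := p.norm_sq_le_bilin x v
    rw [hv, zero_apply] at h
    exact norm_eq_zero.1 (pow_eq_zero_iff two_ne_zero |>.1 (le_antisymm h (sq_nonneg _)))
  have hrank : Module.finrank ℝ E = Module.finrank ℝ (E →L[ℝ] ℝ) :=
    (InnerProductSpace.toDual ℝ E).toLinearEquiv.finrank_eq
  have : FiniteDimensional ℝ (E →L[ℝ] ℝ) :=
    (InnerProductSpace.toDual ℝ E).toLinearEquiv.finiteDimensional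
  let e : E ≃ₗ[ℝ] (E →L[ℝ] ℝ) := LinearEquiv.ofInjectiveOfFinrankEq
    (p.bilin x : E →ₗ[ℝ] (E →L[ℝ] ℝ)) hinj hrank
  exact ⟨e.toContinuousLinearEquiv, rfl⟩

theorem inverse_bilin [FiniteDimensional ℝ E] {x v : E} {l : E →L[ℝ] ℝ} (h : p.bilin x v = l) :
    (p.bilin x).inverse l = v := by
  rw [← h, (p.isInvertible_bilin x).inverse_apply_self]

end Profile

/-! ### Christoffel symbols and curvature of radial metrics -/

section Radial

variable {E : Type} [NormedAddCommGroup E] [InnerProductSpace ℝ E]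

theorem hasFDerivAt_radial {f : ℝ → ℝ} {f' : ℝ} {x : E} (hf : HasDerivAt f f' (‖x‖ ^ 2)) :
    HasFDerivAt (fun y : E => f (‖y‖ ^ 2)) ((2 * f') • Profile.euclid E x) x := by
  have h := hf.comp_hasFDerivAt x (hasStrictFDerivAt_norm_sq x).hasFDerivAt
  refine h.congr_fderiv (ContinuousLinearMap.ext fun v => ?_)
  simp only [Profile.euclid_apply, smul_apply, nsmul_eq_mul, smul_eq_mul, innerSL_apply_apply]
  push_cast
  ring

theorem hasFDerivAt_euclid (x w : E) :
    HasFDerivAt (fun y : E => inner ℝ y w) ((Profile.euclid E).flip w) x :=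
  ((Profile.euclid E).flip w).hasFDerivAt

end Radial

namespace Profile

variable (p : Profile) {E : Type} [NormedAddCommGroup E] [InnerProductSpace ℝ E]

theorem fderiv_bilin_apply (x v w z : E) : fderiv ℝ p.bilin x v w z =
    2 * deriv p.a (‖x‖ ^ 2) * inner ℝ x v * inner ℝ w z +
      2 * deriv p.b (‖x‖ ^ 2) * inner ℝ x v * (inner ℝ x w * inner ℝ x z) +
      p.b (‖x‖ ^ 2) * (inner ℝ v w * inner ℝ x z + inner ℝ x w * inner ℝ v z) := by
  have h := (p.contDiff_bilin.differentiable (by simp) x).hasFDerivAt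
  have h1 := (h.clm_apply (hasFDerivAt_const w x)).clm_apply (hasFDerivAt_const z x)
  have ha := (p.contDiff_a.differentiable (by simp) (‖x‖ ^ 2)).hasDerivAt
  have h2 := ((hasFDerivAt_radial (x := x) ha).mul_const (inner ℝ w z)).add
    ((hasFDerivAt_radial (x := x) (p.hasDerivAt_b _)).mul
      ((hasFDerivAt_euclid x w).mul (hasFDerivAt_euclid x z)))
  have h3 := h1.unique (h2.congr_of_eventuallyEq
    (Eventually.of_forall fun y => p.bilin_apply y w z))
  have h4 := congrArg (fun l => l v) h3
  simp [euclid_apply] at h4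
  rw [h4]
  ring

/-- The coefficient of `⟪v, w⟫ x` in the Christoffel symbols. -/
def c₁ (t : ℝ) : ℝ := p.b t - deriv p.a t

/-- The coefficient of `⟪x, v⟫ ⟪x, w⟫ x` in the Christoffel symbols. -/
def c₂ (t : ℝ) : ℝ := deriv p.b t - 2 * p.b t * deriv p.toFun t

theorem deriv_c₁ (t : ℝ) : deriv p.c₁ t = deriv p.b t -
    (p.a t * deriv p.toFun t ^ 2 + p.a t * deriv (deriv p.toFun) t) := by
  have h1 : HasDerivAt (deriv p.toFun) (deriv (deriv p.toFun) t) t :=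
    ((contDiff_infty_iff_deriv.1 p.smooth).2.differentiable (by simp) t).hasDerivAt
  have h2 := (p.hasDerivAt_a t).mul h1
  have h3 : HasDerivAt (deriv p.a) _ t :=
    h2.congr_of_eventuallyEq (Eventually.of_forall p.deriv_a)
  refine ((p.hasDerivAt_b t).sub h3).deriv.trans ?_
  ring

/-- It suffices to lower the index of the proposed vector and compare covectors; a + tb = 1 absorbs
the multiple of x. -/
theorem christoffel_metric [FiniteDimensional ℝ E] (x v w : E) :
    christoffel p.metric x v w =
      deriv p.toFun (‖x‖ ^ 2) • (inner ℝ x v • w + inner ℝ x w • v) +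
        (p.c₁ (‖x‖ ^ 2) * inner ℝ v w + p.c₂ (‖x‖ ^ 2) * (inner ℝ x v * inner ℝ x w)) • x := by
  rw [christoffel, form_metric]
  refine p.inverse_bilin (ContinuousLinearMap.ext fun z => ?_)
  simp only [bilin_apply, inner_add_left, inner_add_right, real_inner_smul_left,
    real_inner_smul_right, smul_apply, add_apply, sub_apply, ContinuousLinearMap.flip_apply,
    fderiv_bilin_apply, smul_eq_mul, real_inner_self_eq_norm_sq]
  rw [real_inner_comm v z, real_inner_comm w z, real_inner_comm v w]
  have h1 := p.a_add (‖x‖ ^ 2)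
  have h2 := p.deriv_a (‖x‖ ^ 2)
  rw [c₁, c₂]
  linear_combination ((p.b (‖x‖ ^ 2) - deriv p.a (‖x‖ ^ 2)) * inner ℝ v w +
    (deriv p.b (‖x‖ ^ 2) - 2 * p.b (‖x‖ ^ 2) * deriv p.toFun (‖x‖ ^ 2)) *
      (inner ℝ x v * inner ℝ x w)) * inner ℝ x z * h1 -
    (inner ℝ x v * inner ℝ w z + inner ℝ x w * inner ℝ v z) * h2

theorem fderiv_christoffel_metric [FiniteDimensional ℝ E] (x v w z : E) :
    fderiv ℝ (fun y => christoffel p.metric y w z) x v =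
      deriv p.toFun (‖x‖ ^ 2) • (inner ℝ v w • z + inner ℝ v z • w) +
      (2 * deriv (deriv p.toFun) (‖x‖ ^ 2) * inner ℝ x v) • (inner ℝ x w • z + inner ℝ x z • w) +
      (p.c₁ (‖x‖ ^ 2) * inner ℝ w z + p.c₂ (‖x‖ ^ 2) * (inner ℝ x w * inner ℝ x z)) • v +
      (2 * deriv p.c₁ (‖x‖ ^ 2) * inner ℝ x v * inner ℝ w z +
        2 * deriv p.c₂ (‖x‖ ^ 2) * inner ℝ x v * (inner ℝ x w * inner ℝ x z) +
        p.c₂ (‖x‖ ^ 2) * (inner ℝ v w * inner ℝ x z + inner ℝ x w * inner ℝ v z)) • x := by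
  have s1 : ContDiff ℝ ∞ (deriv p.toFun) := (contDiff_infty_iff_deriv.1 p.smooth).2
  have s2 : ContDiff ℝ ∞ (deriv p.a) := (contDiff_infty_iff_deriv.1 p.contDiff_a).2
  have s3 : ContDiff ℝ ∞ (deriv p.b) := (contDiff_infty_iff_deriv.1 p.contDiff_b).2
  have s4 : ContDiff ℝ ∞ p.c₁ := p.contDiff_b.sub s2
  have s5 : ContDiff ℝ ∞ p.c₂ := s3.sub ((contDiff_const.mul p.contDiff_b).mul s1)
  have hd {f : ℝ → ℝ} (hf : ContDiff ℝ ∞ f) :=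
    hasFDerivAt_radial (x := x) (hf.differentiable (by simp) _).hasDerivAt
  have h := ((hd s1).smul (((hasFDerivAt_euclid x w).smul_const z).add
    ((hasFDerivAt_euclid x z).smul_const w))).add
      ((((hd s4).mul_const (inner ℝ w z)).add
        ((hd s5).mul ((hasFDerivAt_euclid x w).mul (hasFDerivAt_euclid x z)))).smul
          (hasFDerivAt_id x))
  have h2 := h.congr_of_eventuallyEq (Eventually.of_forall fun y => p.christoffel_metric y w z)
  rw [h2.fderiv]
  simp [euclid_apply]
  module

theorem riemann_metric [FiniteDimensional ℝ E] (x v w : E) :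
    p.bilin x (riemann p.metric x v w w) v =
      p.a (‖x‖ ^ 2) * (p.b (‖x‖ ^ 2) - 2 * deriv p.a (‖x‖ ^ 2) -
        ‖x‖ ^ 2 * p.a (‖x‖ ^ 2) * deriv p.toFun (‖x‖ ^ 2) ^ 2) *
          (inner ℝ v v * inner ℝ w w - inner ℝ v w ^ 2) +
      (deriv p.b (‖x‖ ^ 2) + p.b (‖x‖ ^ 2) ^ 2 - 2 * p.b (‖x‖ ^ 2) * deriv p.a (‖x‖ ^ 2) -
        p.a (‖x‖ ^ 2) * deriv p.toFun (‖x‖ ^ 2) ^ 2 -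
        2 * p.a (‖x‖ ^ 2) * deriv (deriv p.toFun) (‖x‖ ^ 2) +
        p.a (‖x‖ ^ 2) ^ 2 * deriv p.toFun (‖x‖ ^ 2) ^ 2) *
          (inner ℝ x v ^ 2 * inner ℝ w w - 2 * inner ℝ x v * inner ℝ x w * inner ℝ v w +
            inner ℝ x w ^ 2 * inner ℝ v v) := by
  rw [riemann, fderiv_christoffel_metric, fderiv_christoffel_metric]
  simp only [christoffel_metric, bilin_apply, inner_add_left, inner_sub_left, inner_sub_right,
    inner_add_right, real_inner_smul_left, real_inner_smul_right]
  rw [real_inner_comm v w, real_inner_comm x v, real_inner_comm x w,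
    real_inner_self_eq_norm_sq x]
  have h1 := p.a_add (‖x‖ ^ 2)
  have h2 := p.deriv_a (‖x‖ ^ 2)
  have h3 := p.deriv_b (‖x‖ ^ 2)
  have h4 := p.deriv_c₁ (‖x‖ ^ 2)
  rw [h4, c₁, c₂, h2]
  rw [h2] at h3
  generalize ‖x‖ ^ 2 = t at *
  generalize p.a t = a at *
  generalize p.b t = b at *
  generalize deriv p.b t = b' at *
  generalize deriv p.toFun t = A at *
  generalize deriv (deriv p.toFun) t = A' at *
  generalize deriv p.c₂ t = C' at *
  generalize inner ℝ v v = vv at *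
  generalize inner ℝ v w = vw at *
  generalize inner ℝ w w = ww at *
  generalize inner ℝ x v = xv at *
  generalize inner ℝ x w = xw at *
  -- The curvature is compared coefficient by coefficient in the inner products; each identity holds
  -- modulo a + tb = 1 and, for `i2` and `i3`, its derivative.
  have i1 : (b - a * A) + A * (b - a * A) * t - A = b - 2 * (a * A) - t * a * A ^ 2 := by
    linear_combination A * h1
  have i2 : a * (2 * A' - (b' - 2 * b * A) - A ^ 2 - A * (b' - 2 * b * A) * t) =
      -(b' + b ^ 2 - 2 * b * (a * A) - a * A ^ 2 - 2 * a * A' + a ^ 2 * A ^ 2) := by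
    linear_combination (2 * a * A ^ 2 - b') * h1 + (b - a * A) * h3
  have i3 : 2 * (b' - (a * A ^ 2 + a * A')) - (b' - 2 * b * A) + (b - a * A) ^ 2 +
      t * (b - a * A) * (b' - 2 * b * A) + b * (b - 2 * (a * A) - t * a * A ^ 2) =
      b' + b ^ 2 - 2 * b * (a * A) - a * A ^ 2 - 2 * a * A' + a ^ 2 * A ^ 2 := by
    linear_combination (a * A ^ 2 - 2 * b * A) * h1 + (b - a * A) * h3
  linear_combination (a * (vv * ww - vw ^ 2) + b * xv * (xv * ww - xw * vw)) * i1 -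
    (xw ^ 2 * vv - xv * xw * vw) * i2 + (xv ^ 2 * ww - xv * xw * vw) * i3 +
    (2 * (b' - (a * A ^ 2 + a * A')) - (b' - 2 * b * A) + (b - a * A) ^ 2 +
      t * (b - a * A) * (b' - 2 * b * A)) * (xv ^ 2 * ww - xv * xw * vw) * h1

theorem gram_two_nonneg (x v w : E) :
    0 ≤ inner ℝ x v ^ 2 * inner ℝ w w - 2 * inner ℝ x v * inner ℝ x w * inner ℝ v w +
      inner ℝ x w ^ 2 * inner ℝ v v := by
  have h := real_inner_self_nonneg (x := inner ℝ x v • w - inner ℝ x w • v)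
  simp only [inner_sub_left, inner_sub_right, real_inner_smul_left, real_inner_smul_right] at h
  rw [real_inner_comm v w] at h
  linarith

/-- Cauchy–Schwarz for t times the components of v and w orthogonal to x; the difference of its two
sides carries a factor t³. -/
theorem gram_three_nonneg (x v w : E) :
    inner ℝ x v ^ 2 * inner ℝ w w - 2 * inner ℝ x v * inner ℝ x w * inner ℝ v w +
      inner ℝ x w ^ 2 * inner ℝ v v ≤
        ‖x‖ ^ 2 * (inner ℝ v v * inner ℝ w w - inner ℝ v w ^ 2) := by
  rcases eq_or_ne x 0 with rfl | hx
  · simp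
  · have ht : 0 < ‖x‖ ^ 2 := by positivity
    have h := real_inner_mul_inner_self_le (‖x‖ ^ 2 • v - inner ℝ x v • x)
      (‖x‖ ^ 2 • w - inner ℝ x w • x)
    simp only [inner_sub_left, inner_sub_right, real_inner_smul_left, real_inner_smul_right,
      real_inner_self_eq_norm_sq x] at h
    rw [real_inner_comm x v, real_inner_comm x w] at h
    generalize ‖x‖ ^ 2 = t at *
    refine sub_nonneg.1 (nonneg_of_mul_nonneg_right ?_ (pow_pos ht 3))
    linarith

/-- The hypotheses control the tangential curvature (1 - ψ'²)/ψ² and the radial one, -ψ''/ψ = -(3Λ'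
+ tΛ'² + 2tΛ''). Any other plane gives a combination of these with nonnegative weights tP - Q and Q,
where P is the Gram determinant of v, w and Q = |⟨x,v⟩w - ⟨x,w⟩v|². -/
theorem sectionalCurvature_metric_nonpos [FiniteDimensional ℝ E]
    (h1 : ∀ t, 0 ≤ t → 0 ≤ deriv p.toFun t)
    (h2 : ∀ t, 0 ≤ t → 0 ≤ 3 * deriv p.toFun t + 2 * t * deriv (deriv p.toFun) t) (x v w : E) :
    sectionalCurvature p.metric x v w ≤ 0 := by
  have hP : 0 ≤ inner ℝ v v * inner ℝ w w - inner ℝ v w ^ 2 := by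
    rw [sq]
    exact sub_nonneg.2 (real_inner_mul_inner_self_le v w)
  have ht : 0 ≤ ‖x‖ ^ 2 := sq_nonneg _
  have hq := gram_two_nonneg x v w
  have hQ := gram_three_nonneg x v w
  have ha := p.one_le_a ht
  have e1 := p.a_add (‖x‖ ^ 2)
  have e2 := p.deriv_a (‖x‖ ^ 2)
  have e3 := p.deriv_b (‖x‖ ^ 2)
  have hA := h1 _ ht
  have hA' := h2 _ ht
  -- At the pole tb = 1 - a says nothing about b, but its derivative gives b(0) = -a'(0).
  have hb : ‖x‖ ^ 2 = 0 → p.b (‖x‖ ^ 2) ≤ 0 := by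
    intro h
    rw [h] at e2 e3 hA
    rw [h]
    nlinarith [p.a_pos 0]
  rw [sectionalCurvature, form_metric]
  refine div_nonpos_of_nonpos_of_nonneg ?_ ?_
  · rw [riemann_metric]
    rw [e2] at e3 ⊢
    generalize inner ℝ x v ^ 2 * inner ℝ w w - 2 * inner ℝ x v * inner ℝ x w * inner ℝ v w +
      inner ℝ x w ^ 2 * inner ℝ v v = Q at *
    generalize inner ℝ v v * inner ℝ w w - inner ℝ v w ^ 2 = P at *
    generalize ‖x‖ ^ 2 = t at *
    generalize p.a t = a at *
    generalize p.b t = b at *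
    generalize deriv p.b t = b' at *
    generalize deriv p.toFun t = A at *
    generalize deriv (deriv p.toFun) t = A' at *
    have hs : b - 2 * (a * A) - t * a * A ^ 2 ≤ 0 := by
      have hb0 : b ≤ 0 := by
        rcases ht.eq_or_lt with h | h
        · exact hb h.symm
        · by_contra! h'
          nlinarith
      have : 0 ≤ a * A := by positivity
      have : 0 ≤ t * a * A ^ 2 := by positivity
      linarith
    have hr : a * (b - 2 * (a * A) - t * a * A ^ 2) +
        t * (b' + b ^ 2 - 2 * b * (a * A) - a * A ^ 2 - 2 * a * A' + a ^ 2 * A ^ 2) = -a * (3 * A + t * A ^ 2 + 2 * t * A') := by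
      linear_combination e3 + (b - 2 * a * A) * e1
    have hr' : -a * (3 * A + t * A ^ 2 + 2 * t * A') ≤ 0 := by
      have : 0 ≤ a * (3 * A + t * A ^ 2 + 2 * t * A') :=
        mul_nonneg (by linarith) (by nlinarith [mul_nonneg ht (sq_nonneg A)])
      linarith
    rcases ht.eq_or_lt with h | h
    · subst h
      have : Q = 0 := by linarith
      rw [this, mul_zero, add_zero]
      exact mul_nonpos_of_nonpos_of_nonneg (mul_nonpos_of_nonneg_of_nonpos (by linarith) hs) hP
    · refine le_of_mul_le_mul_left ?_ h
      -- Multiplied by t, the numerator splits as (tangential term)(tP - Q) + (radial term)Q, the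
      -- radial term being `hr`.
      have k1 : a * (b - 2 * (a * A) - t * a * A ^ 2) * (t * P - Q) ≤ 0 :=
        mul_nonpos_of_nonpos_of_nonneg (mul_nonpos_of_nonneg_of_nonpos (by linarith) hs)
          (sub_nonneg.2 hQ)
      have k2 := mul_nonpos_of_nonpos_of_nonneg hr' hq
      rw [← hr] at k2
      linarith
  · simp only [bilin_apply]
    generalize ‖x‖ ^ 2 = t at *
    generalize p.a t = a at *
    generalize p.b t = b at *
    have key : (a * inner ℝ v v + b * (inner ℝ x v * inner ℝ x v)) *
        (a * inner ℝ w w + b * (inner ℝ x w * inner ℝ x w)) -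
        (a * inner ℝ v w + b * (inner ℝ x v * inner ℝ x w)) ^ 2 =
        a * (a * (inner ℝ v v * inner ℝ w w - inner ℝ v w ^ 2) +
          b * (inner ℝ x v ^ 2 * inner ℝ w w - 2 * inner ℝ x v * inner ℝ x w * inner ℝ v w +
            inner ℝ x w ^ 2 * inner ℝ v v)) := by ring
    rw [key]
    generalize inner ℝ x v ^ 2 * inner ℝ w w - 2 * inner ℝ x v * inner ℝ x w * inner ℝ v w +
      inner ℝ x w ^ 2 * inner ℝ v v = Q at *
    generalize inner ℝ v v * inner ℝ w w - inner ℝ v w ^ 2 = P at *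
    refine mul_nonneg (by linarith) ?_
    rcases ht.eq_or_lt with h | h
    · subst h
      have : Q = 0 := by linarith
      rw [this, mul_zero, add_zero]
      exact mul_nonneg (by linarith) hP
    · refine nonneg_of_mul_nonneg_right (a := t) ?_ h
      have : t * (a * P + b * Q) = a * (t * P - Q) + Q := by linear_combination Q * e1
      rw [this]
      exact add_nonneg (mul_nonneg (by linarith) (sub_nonneg.2 hQ)) hq

end Profile

/-! ### Completeness and the Cartan–Hadamard property -/

namespace Profile

variable (p : Profile)

section Completeness

variable {E : Type} [NormedAddCommGroup E] [InnerProductSpace ℝ E]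

theorem ofReal_sqrt_bilin_smul (x : E) (c : ℝ) (v : E) :
    ENNReal.ofReal (Real.sqrt (p.bilin x (c • v) (c • v))) =
      ‖c‖ₑ * ENNReal.ofReal (Real.sqrt (p.bilin x v v)) := by
  have h : p.bilin x (c • v) (c • v) = c ^ 2 * p.bilin x v v := by
    simp
    ring
  rw [h, Real.sqrt_mul (sq_nonneg c), Real.sqrt_sq_eq_abs, ENNReal.ofReal_mul (abs_nonneg c),
    ← Real.norm_eq_abs, ofReal_norm]

theorem edist_le_riemDist (x y : E) : edist x y ≤ riemDist p.metric x y := by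
  unfold riemDist
  let _ : ∀ z : E, ENorm (TangentSpace 𝓘(ℝ, E) z) :=
    fun z => ⟨fun v => ENNReal.ofReal (Real.sqrt (p.metric.inner z v v))⟩
  change edist x y ≤ riemannianEDist 𝓘(ℝ, E) x y
  simp only [riemannianEDist, le_iInf_iff]
  intro γ hγ
  let e : ℝ → E := γ ∘ (projIcc 0 1 zero_le_one)
  have D : ContDiffOn ℝ 1 e (Icc 0 1) :=
    contMDiffOn_iff_contDiffOn.mp (hγ.comp_contMDiffOn contMDiffOn_projIcc)
  rw [lintegral_norm_mfderiv_Icc_eq_pathELength_projIcc, pathELength_eq_lintegral_mfderivWithin_Icc]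
  simp only [mfderivWithin_eq_fderivWithin]
  have hE : edist x y = ‖e 1 - e 0‖ₑ := by
    rw [edist_comm, edist_eq_enorm_sub]
    simp [e]
  rw [hE]
  refine (enorm_sub_le_lintegral_derivWithin_Icc_of_contDiffOn_Icc D zero_le_one).trans ?_
  refine lintegral_mono fun t => ?_
  change ‖derivWithin e (Icc 0 1) t‖ₑ ≤ ENNReal.ofReal (Real.sqrt (p.bilin (e t)
    (derivWithin e (Icc 0 1) t) (derivWithin e (Icc 0 1) t)))
  rw [← ofReal_norm]
  exact ENNReal.ofReal_le_ofReal (Real.le_sqrt_of_sq_le (p.norm_sq_le_bilin _ _))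

theorem riemDist_le {C : ℝ} {x y : E} (h : ∀ z ∈ segment ℝ x y, ‖p.bilin z‖ ≤ C) :
    riemDist p.metric x y ≤ ENNReal.ofReal (Real.sqrt C * ‖y - x‖) := by
  unfold riemDist
  let _ : ∀ z : E, ENorm (TangentSpace 𝓘(ℝ, E) z) :=
    fun z => ⟨fun v => ENNReal.ofReal (Real.sqrt (p.metric.inner z v v))⟩
  have : ∀ z : E, ENormSMulClass ℝ (TangentSpace 𝓘(ℝ, E) z) :=
    fun z => ⟨fun c v => p.ofReal_sqrt_bilin_smul (E := E) z c v⟩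
  change riemannianEDist 𝓘(ℝ, E) x y ≤ _
  let γ := ContinuousAffineMap.lineMap (R := ℝ) x y
  have h1 : riemannianEDist 𝓘(ℝ, E) x y ≤ pathELength 𝓘(ℝ, E) γ 0 1 := by
    apply riemannianEDist_le_pathELength ?_ (by simp [γ, ContinuousAffineMap.coe_lineMap_eq])
      (by simp [γ, ContinuousAffineMap.coe_lineMap_eq]) zero_le_one
    rw [contMDiffOn_iff_contDiffOn]
    exact γ.contDiff.contDiffOn
  refine h1.trans ?_
  rw [pathELength_eq_lintegral_mfderivWithin_Icc]
  simp only [mfderivWithin_eq_fderivWithin]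
  have h2 : ∀ t ∈ Icc (0 : ℝ) 1, fderivWithin ℝ γ (Icc 0 1) t 1 = y - x := by
    intro t ht
    rw [fderivWithin_eq_fderiv (uniqueDiffOn_Icc zero_lt_one _ ht)
      (ContinuousAffineMap.differentiableAt _)]
    simp [γ]
  calc _ ≤ ∫⁻ t in Icc (0 : ℝ) 1, ENNReal.ofReal (Real.sqrt C * ‖y - x‖) := by
        refine setLIntegral_mono measurable_const fun t ht => ?_
        change ENNReal.ofReal (Real.sqrt (p.bilin (γ t) (fderivWithin ℝ γ (Icc 0 1) t 1)
          (fderivWithin ℝ γ (Icc 0 1) t 1))) ≤ _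
        rw [h2 t ht]
        refine ENNReal.ofReal_le_ofReal ?_
        rw [← Real.sqrt_sq (norm_nonneg (y - x)), ← Real.sqrt_mul' _ (sq_nonneg _)]
        refine Real.sqrt_le_sqrt ?_
        have h3 := h (γ t) (by
          rw [segment_eq_image_lineMap]
          exact ⟨t, ht, by simp [γ, ContinuousAffineMap.coe_lineMap_eq]⟩)
        calc p.bilin (γ t) (y - x) (y - x) ≤ ‖p.bilin (γ t) (y - x) (y - x)‖ := Real.le_norm_self _
          _ ≤ ‖p.bilin (γ t)‖ * ‖y - x‖ * ‖y - x‖ := (p.bilin (γ t)).le_opNorm₂ _ _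
          _ ≤ C * ‖y - x‖ ^ 2 := by
            rw [sq, mul_assoc]
            gcongr
    _ = _ := by simp

/-- Lengths dominate Euclidean lengths, so a Cauchy sequence has a Euclidean limit; near that limit
the form is bounded, and straight segments show convergence for the Riemannian distance too. -/
theorem isCompleteMetric [CompleteSpace E] : IsCompleteMetric (p.metric (E := E)) := by
  intro s hs
  have hc : CauchySeq s := by
    refine EMetric.cauchySeq_iff.2 fun ε hε => ?_
    obtain ⟨N, hN⟩ := hs ε hε
    exact ⟨N, fun i hi j hj => (p.edist_le_riemDist _ _).trans_lt (hN i j hi hj)⟩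
  obtain ⟨x, hx⟩ := cauchySeq_tendsto_of_complete hc
  refine ⟨x, ?_⟩
  have h1 : ∀ᶠ z in 𝓝 x, ‖p.bilin z‖ < ‖p.bilin x‖ + 1 :=
    (p.contDiff_bilin.continuous.norm.tendsto x).eventually (gt_mem_nhds (by linarith))
  obtain ⟨δ, hδ, hball⟩ := Metric.eventually_nhds_iff_ball.1 h1
  have h2 : ∀ᶠ i in atTop, riemDist p.metric (s i) x ≤
      ENNReal.ofReal (Real.sqrt (‖p.bilin x‖ + 1) * ‖x - s i‖) := by
    filter_upwards [hx.eventually (Metric.ball_mem_nhds x hδ)] with i hi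
    refine p.riemDist_le fun z hz => (hball z ?_).le
    exact (convex_ball x δ).segment_subset hi (Metric.mem_ball_self hδ) hz
  refine tendsto_of_tendsto_of_tendsto_of_le_of_le' tendsto_const_nhds ?_
    (Eventually.of_forall fun _ => zero_le) h2
  have h3 : Tendsto (fun i => Real.sqrt (‖p.bilin x‖ + 1) * ‖x - s i‖) atTop (𝓝 0) := by
    have := ((tendsto_const_nhds (x := x)).sub hx).norm.const_mul (Real.sqrt (‖p.bilin x‖ + 1))
    simpa using this
  simpa using ENNReal.tendsto_ofReal h3

theorem isCartanHadamard [FiniteDimensional ℝ E] (h1 : ∀ t, 0 ≤ t → 0 ≤ deriv p.toFun t)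
    (h2 : ∀ t, 0 ≤ t → 0 ≤ 3 * deriv p.toFun t + 2 * t * deriv (deriv p.toFun) t) :
    IsCartanHadamard (p.metric (E := E)) where
  simplyConnected := inferInstance
  complete :=
    have : CompleteSpace E := FiniteDimensional.complete ℝ E
    p.isCompleteMetric
  curvature_nonpos x v w _ := p.sectionalCurvature_metric_nonpos h1 h2 x v w

end Completeness

/-! ### Model function, volume density and Laplacian in the variable t = |x|² -/

/-- The model function of a radial metric. -/
def model (r : ℝ) : ℝ := r * Real.exp (p.toFun (r ^ 2) / 2)

theorem contDiff_model : ContDiff ℝ ∞ p.model :=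
  contDiff_id.mul (Real.contDiff_exp.comp ((p.smooth.comp (contDiff_id.pow 2)).div_const 2))

theorem hasDerivAt_model (r : ℝ) : HasDerivAt p.model
    (Real.exp (p.toFun (r ^ 2) / 2) * (1 + r ^ 2 * deriv p.toFun (r ^ 2))) r := by
  have h1 : HasDerivAt (fun r : ℝ => r ^ 2) (2 * r) r := by simpa using hasDerivAt_pow 2 r
  have h2 := (((p.smooth.differentiable (by simp) (r ^ 2)).hasDerivAt.comp r h1).div_const 2).exp
  refine ((hasDerivAt_id r).mul h2).congr_deriv ?_
  simp
  ring

theorem isModelFunction_model : IsModelFunction p.model where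
  smooth := p.contDiff_model.contDiffOn
  pos r hr := mul_pos hr (Real.exp_pos _)
  map_zero := by simp [model]
  deriv_zero := by
    rw [((p.hasDerivAt_model 0).hasDerivWithinAt).derivWithin (uniqueDiffOn_Ici 0 0 self_mem_Ici)]
    simp [p.map_zero]
  even_deriv_zero k := by
    rw [iteratedDerivWithin_eq_iteratedDeriv (uniqueDiffOn_Ici 0)
      (contDiff_infty.1 p.contDiff_model (2 * k)).contDiffAt self_mem_Ici]
    -- The model function is r times an even function, so it is odd and its even derivatives vanish
    -- at 0.
    have h1 : (fun r => p.model (-r)) = fun r => -p.model r := by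
      funext r
      simp [model]
    have h2 := iteratedDeriv_comp_neg (2 * k) p.model 0
    rw [h1, iteratedDeriv_fun_neg] at h2
    simp at h2
    linarith

theorem isModelMetric_metric {n : ℕ} : IsModelMetric (n := n) p.metric p.model := by
  intro r θ a b ξ η hr hθ hξ hη
  have h1 := p.a_add (r ^ 2)
  have h2 : Real.exp (p.toFun (r ^ 2) / 2) ^ 2 = p.a (r ^ 2) := by
    rw [Profile.a, ← Real.exp_nat_mul]
    congr 1
    push_cast
    ring
  have h3 : inner ℝ θ θ = 1 := by rw [real_inner_self_eq_norm_sq, hθ, one_pow]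
  have h4 : inner ℝ ξ θ = 0 := by rw [real_inner_comm, hξ]
  rw [form_metric, bilin_apply, norm_smul, hθ, mul_one, Real.norm_eq_abs, sq_abs, model, mul_pow,
    h2]
  simp only [inner_add_left, inner_add_right, real_inner_smul_left, real_inner_smul_right, hξ, hη,
    h3, h4]
  linear_combination a * b * h1

variable {n : ℕ}

/-- The Gram matrix is a multiple of the identity plus a rank one matrix, with determinant aⁿ⁻¹(a +
tb) = aⁿ⁻¹. -/
theorem volDensity_metric (x : Space n) (hn : 1 ≤ n) :
    volDensity p.metric x = Real.exp ((n - 1 : ℝ) / 2 * p.toFun (‖x‖ ^ 2)) := by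
  have h1 : (Matrix.of fun i j : Fin n => form p.metric x (EuclideanSpace.single i 1)
      (EuclideanSpace.single j 1)) = p.a (‖x‖ ^ 2) • (1 + Matrix.replicateCol Unit
        (fun i => p.b (‖x‖ ^ 2) / p.a (‖x‖ ^ 2) * x i) * Matrix.replicateRow Unit
          (fun i => x i)) := by
    ext i j
    have := p.a_pos (‖x‖ ^ 2)
    rw [form_metric, Matrix.of_apply, bilin_apply]
    simp [Matrix.one_apply, EuclideanSpace.inner_single_right, Matrix.mul_apply, eq_comm (a := j)]
    field_simp
    split_ifs <;> ring
  have h2 : (fun i => x i) ⬝ᵥ (fun i => p.b (‖x‖ ^ 2) / p.a (‖x‖ ^ 2) * x i) =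
      p.b (‖x‖ ^ 2) / p.a (‖x‖ ^ 2) * ‖x‖ ^ 2 := by
    rw [EuclideanSpace.real_norm_sq_eq, dotProduct, Finset.mul_sum]
    exact Finset.sum_congr rfl fun i _ => by ring
  have h3 : p.a (‖x‖ ^ 2) * (1 + p.b (‖x‖ ^ 2) / p.a (‖x‖ ^ 2) * ‖x‖ ^ 2) = 1 := by
    have := p.a_pos (‖x‖ ^ 2)
    have := p.a_add (‖x‖ ^ 2)
    field_simp
    linarith
  rw [volDensity, h1, Matrix.det_smul, Matrix.det_one_add_replicateCol_mul_replicateRow, h2,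
    Fintype.card_fin]
  obtain ⟨m, rfl⟩ : ∃ m, n = m + 1 := ⟨n - 1, by omega⟩
  rw [pow_succ, mul_assoc, h3, mul_one, a, ← Real.exp_nat_mul, Real.sqrt_eq_rpow, ← Real.exp_mul]
  congr 1
  push_cast
  ring

theorem fderiv_radial {f : ℝ → ℝ} {f' : ℝ} {x : Space n} (hf : HasDerivAt f f' (‖x‖ ^ 2)) :
    fderiv ℝ (fun y : Space n => f (‖y‖ ^ 2)) x = p.bilin x ((2 * f') • x) := by
  rw [(hasFDerivAt_radial hf).fderiv]
  ext v
  rw [bilin_apply, smul_apply, euclid_apply, real_inner_smul_left, real_inner_smul_right,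
    real_inner_self_eq_norm_sq, smul_eq_mul]
  linear_combination (-(2 * f' * inner ℝ x v)) * p.a_add (‖x‖ ^ 2)

theorem grad_radial {f : ℝ → ℝ} {f' : ℝ} {x : Space n} (hf : HasDerivAt f f' (‖x‖ ^ 2)) :
    grad p.metric (fun y : Space n => f (‖y‖ ^ 2)) x = (2 * f') • x := by
  rw [grad, form_metric]
  exact p.inverse_bilin (p.fderiv_radial hf).symm

theorem form_grad_radial {f : ℝ → ℝ} {f' : ℝ} {x : Space n} (hf : HasDerivAt f f' (‖x‖ ^ 2)) :
    form p.metric x (grad p.metric (fun y : Space n => f (‖y‖ ^ 2)) x)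
      (grad p.metric (fun y : Space n => f (‖y‖ ^ 2)) x) = 4 * ‖x‖ ^ 2 * f' ^ 2 := by
  rw [p.grad_radial hf, form_metric, bilin_apply]
  rw [real_inner_smul_left, real_inner_smul_right,
    real_inner_self_eq_norm_sq]
  linear_combination (4 * f' ^ 2 * ‖x‖ ^ 2) * p.a_add (‖x‖ ^ 2)

/-- The gradient of U(|x|²) is 2U'x, as in the Euclidean case, so only the volume density makes the
metric visible in the divergence. -/
theorem laplaceBeltrami_radial (hn : 1 ≤ n) {U : ℝ → ℝ} (hU : ContDiff ℝ 2 U) (x : Space n) :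
    laplaceBeltrami p.metric (fun y => U (‖y‖ ^ 2)) x =
      4 * ‖x‖ ^ 2 * deriv (deriv U) (‖x‖ ^ 2) +
        (2 * n + 2 * (n - 1) * ‖x‖ ^ 2 * deriv p.toFun (‖x‖ ^ 2)) * deriv U (‖x‖ ^ 2) := by
  have hU1 : Differentiable ℝ U := hU.differentiable two_ne_zero
  have hU2 : Differentiable ℝ (deriv U) :=
    ((contDiff_succ_iff_deriv (n := 1)).1 hU).2.2.differentiable one_ne_zero
  set t := ‖x‖ ^ 2 with ht
  set W : ℝ → ℝ := fun t => Real.exp ((n - 1 : ℝ) / 2 * p.toFun t) with hW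
  have hWt : HasDerivAt W (W t * ((n - 1 : ℝ) / 2 * deriv p.toFun t)) t :=
    (((p.smooth.differentiable (by simp)) t).hasDerivAt.const_mul _).exp
  have hM : HasDerivAt (fun t => W t * (2 * deriv U t)) _ t :=
    hWt.mul ((hU2 t).hasDerivAt.const_mul 2)
  have h1 : ∀ i : Fin n, fderiv ℝ (fun y => volDensity p.metric y *
      grad p.metric (fun y : Space n => U (‖y‖ ^ 2)) y i) x (EuclideanSpace.single i 1) =
      2 * (W t * ((n - 1 : ℝ) / 2 * deriv p.toFun t) * (2 * deriv U t) +
        W t * (2 * deriv (deriv U) t)) * x i ^ 2 + W t * (2 * deriv U t) := by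
    intro i
    have h2 : (fun y => volDensity p.metric y *
        grad p.metric (fun y : Space n => U (‖y‖ ^ 2)) y i) =
        fun y => (fun t => W t * (2 * deriv U t)) (‖y‖ ^ 2) *
          (EuclideanSpace.proj i : Space n →L[ℝ] ℝ) y := by
      funext y
      rw [p.volDensity_metric y hn, p.grad_radial (hU1 _).hasDerivAt]
      simp [hW]
      ring
    have h3 := (hasFDerivAt_radial hM).mul
      (EuclideanSpace.proj i : Space n →L[ℝ] ℝ).hasFDerivAt
    rw [h2]
    refine (congrArg (fun l => l (EuclideanSpace.single i 1)) h3.fderiv).trans ?_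
    simp [euclid_apply, EuclideanSpace.inner_single_right]
    ring
  rw [laplaceBeltrami, Finset.sum_congr rfl fun i _ => h1 i, Finset.sum_add_distrib,
    ← Finset.mul_sum, ← EuclideanSpace.real_norm_sq_eq, ← ht, p.volDensity_metric x hn, ← ht]
  have hWpos : W t ≠ 0 := (Real.exp_pos _).ne'
  change (W t)⁻¹ * _ = _
  simp only [Finset.sum_const, Finset.card_univ, Fintype.card_fin, nsmul_eq_mul]
  field_simp
  ring

end Profile

/-! ### Truncation of values and the energy space -/

/-- The continuous ramp from `0` on `(-∞, δ]` to `1` on `[2 δ, ∞)`. -/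
def ramp (δ s : ℝ) : ℝ := max 0 (min 1 ((s - δ) / δ))

theorem continuous_ramp (δ : ℝ) : Continuous (ramp δ) := by
  unfold ramp
  fun_prop

theorem ramp_nonneg (δ s : ℝ) : 0 ≤ ramp δ s := le_max_left _ _

theorem ramp_le_one (δ s : ℝ) : ramp δ s ≤ 1 := max_le zero_le_one (min_le_left _ _)

theorem ramp_eq_zero {δ s : ℝ} (hδ : 0 < δ) (h : s ≤ δ) : ramp δ s = 0 :=
  max_eq_left ((min_le_right _ _).trans (div_nonpos_of_nonpos_of_nonneg (by linarith) hδ.le))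

theorem ramp_eq_one {δ s : ℝ} (hδ : 0 < δ) (h : 2 * δ ≤ s) : ramp δ s = 1 := by
  have : 1 ≤ (s - δ) / δ := by
    rw [le_div_iff₀ hδ]
    linarith
  rw [ramp, min_eq_left this, max_eq_right zero_le_one]

/-- A `C¹` truncation of the identity which vanishes on `(-∞, δ]`. -/
def truncation (δ s : ℝ) : ℝ := ∫ τ in (0 : ℝ)..s, ramp δ τ

theorem hasDerivAt_truncation (δ s : ℝ) : HasDerivAt (truncation δ) (ramp δ s) s :=
  intervalIntegral.integral_hasDerivAt_right ((continuous_ramp δ).intervalIntegrable _ _)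
    (continuous_ramp δ).aestronglyMeasurable.stronglyMeasurableAtFilter
    (continuous_ramp δ).continuousAt

theorem contDiff_truncation (δ : ℝ) : ContDiff ℝ 1 (truncation δ) := by
  refine contDiff_one_iff_deriv.2 ⟨fun s => (hasDerivAt_truncation δ s).differentiableAt, ?_⟩
  rw [funext fun s => (hasDerivAt_truncation δ s).deriv]
  exact continuous_ramp δ

theorem truncation_eq_zero {δ s : ℝ} (hδ : 0 < δ) (hs : s ≤ δ) : truncation δ s = 0 := by
  refine intervalIntegral.integral_zero_ae (Eventually.of_forall fun τ hτ => ramp_eq_zero hδ ?_)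
  exact hτ.2.trans (max_le hδ.le hs)

/-- Beyond 2δ the slope is 1, so the whole error is accumulated on [0, 2δ]. -/
theorem abs_truncation_sub_le {δ s : ℝ} (hδ : 0 < δ) (hs : 2 * δ ≤ s) :
    |truncation δ s - s| ≤ 2 * δ := by
  have hi (a b : ℝ) := (continuous_ramp δ).intervalIntegrable (μ := volume) a b
  have h1 : truncation δ s = truncation δ (2 * δ) + (s - 2 * δ) := by
    rw [truncation, ← intervalIntegral.integral_add_adjacent_intervals (hi 0 (2 * δ)) (hi _ s)]
    congr 1
    rw [intervalIntegral.integral_congr (g := fun _ => (1 : ℝ)) fun τ hτ => ?_]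
    · simp
    · rw [uIcc_of_le hs] at hτ
      exact ramp_eq_one hδ hτ.1
  have h2 : 0 ≤ truncation δ (2 * δ) :=
    intervalIntegral.integral_nonneg (by linarith) fun τ _ => ramp_nonneg δ τ
  have h3 : truncation δ (2 * δ) ≤ ∫ _ in (0 : ℝ)..(2 * δ), (1 : ℝ) :=
    intervalIntegral.integral_mono_on (by linarith) (hi _ _) intervalIntegrable_const
      fun τ _ => ramp_le_one δ τ
  simp at h3
  rw [abs_le]
  constructor <;> linarith

namespace Profile

variable (p : Profile) {n : ℕ}

theorem energy_radial {F F' : ℝ → ℝ} (hF : ∀ t, HasDerivAt F (F' t) t) :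
    energy (n := n) p.metric (fun y => F (‖y‖ ^ 2)) =
      ∫⁻ x : Space n, ENNReal.ofReal (4 * ‖x‖ ^ 2 * F' (‖x‖ ^ 2) ^ 2) ∂(riemVolume p.metric) := by
  rw [energy]
  exact lintegral_congr fun x => by rw [p.form_grad_radial (hF _)]

/-- Comparison with (1 + |x|²)^{-r/2}, integrable on ℝⁿ for r > n. -/
theorem lintegral_riemVolume_lt_top (hn : 1 ≤ n) {f : ℝ → ℝ} (hf : Continuous f) {C r : ℝ}
    (hr : n < r) (h : ∀ t, 0 ≤ t → f t * Real.exp ((n - 1 : ℝ) / 2 * p.toFun t) ≤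
      C * (1 + t) ^ (-r / 2)) :
    ∫⁻ x : Space n, ENNReal.ofReal (f (‖x‖ ^ 2)) ∂(riemVolume p.metric) < ⊤ := by
  have hv : volDensity (n := n) p.metric =
      fun x => Real.exp ((n - 1 : ℝ) / 2 * p.toFun (‖x‖ ^ 2)) :=
    funext fun x => p.volDensity_metric x hn
  have hm : Measurable fun x : Space n => ENNReal.ofReal (volDensity p.metric x) := by
    rw [hv]
    have := p.smooth.continuous
    exact ENNReal.measurable_ofReal.comp (Continuous.measurable (by fun_prop))
  have hfm : Measurable fun x : Space n => ENNReal.ofReal (f (‖x‖ ^ 2)) :=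
    ENNReal.measurable_ofReal.comp (Continuous.measurable (by fun_prop))
  have hint := (integrable_rpow_neg_one_add_norm_sq (E := Space n) (μ := volume) (r := r)
    (by simpa using hr)).const_mul C
  rw [riemVolume, lintegral_withDensity_eq_lintegral_mul _ hm hfm]
  refine lt_of_le_of_lt (lintegral_mono fun x => ?_) hint.lintegral_lt_top
  rw [Pi.mul_apply, mul_comm, hv, ← ENNReal.ofReal_mul' (Real.exp_pos _).le]
  exact ENNReal.ofReal_le_ofReal (h _ (sq_nonneg _))

/-- The approximants truncate the values of u instead of multiplying by a cutoff. They have compact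
support because U → 0, and the gradient error is |∇u| times a factor in [0, 1] that eventually
vanishes at each point, so dominated convergence applies with no error from a cutoff. -/
theorem memD12Rad (hn : 1 ≤ n) {U : ℝ → ℝ} (hU : ContDiff ℝ 1 U) (hpos : ∀ t, 0 ≤ t → 0 < U t)
    (hlim : Tendsto U atTop (𝓝 0)) {C r : ℝ} (hr : n < r)
    (h : ∀ t, 0 ≤ t → 4 * t * deriv U t ^ 2 * Real.exp ((n - 1 : ℝ) / 2 * p.toFun t) ≤
      C * (1 + t) ^ (-r / 2)) :
    MemD12Rad (n := n) p.metric fun x => U (‖x‖ ^ 2) := by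
  have hd (t : ℝ) : HasDerivAt U (deriv U t) t := (hU.differentiable one_ne_zero t).hasDerivAt
  have hUr : ContDiff ℝ 1 fun x : Space n => U (‖x‖ ^ 2) := hU.comp (contDiff_norm_sq ℝ)
  have hdc := hU.continuous_deriv le_rfl
  have hfin := p.lintegral_riemVolume_lt_top hn (f := fun t => 4 * t * deriv U t ^ 2)
    (by fun_prop) hr h
  set δ : ℕ → ℝ := fun k => 1 / ((k : ℝ) + 1) with hδ
  have hδ0 (k : ℕ) : 0 < δ k := by positivity
  have hδl : Tendsto δ atTop (𝓝 0) := tendsto_one_div_add_atTop_nhds_zero_nat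
  have hev (x : Space n) : ∀ᶠ k in atTop, 2 * δ k ≤ U (‖x‖ ^ 2) := by
    have h1 : Tendsto (fun k => 2 * δ k) atTop (𝓝 0) := by simpa using hδl.const_mul 2
    exact (h1.eventually (gt_mem_nhds (hpos _ (sq_nonneg ‖x‖)))).mono fun k hk => le_of_lt hk
  refine ⟨hUr, ⟨fun s => U (s ^ 2), fun _ => rfl⟩, fun k x => truncation (δ k) (U (‖x‖ ^ 2)),
    fun k => ⟨(contDiff_truncation _).comp hUr, ?_, ⟨fun s => truncation (δ k) (U (s ^ 2)),
      fun _ => rfl⟩⟩, ?_, Eventually.of_forall fun x => ?_⟩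
  · obtain ⟨T, hT⟩ := eventually_atTop.1 (hlim.eventually (gt_mem_nhds (hδ0 k)))
    refine HasCompactSupport.intro (isCompact_closedBall (0 : Space n) (Real.sqrt (max T 0)))
      fun x hx => truncation_eq_zero (hδ0 k) (hT _ ?_).le
    rw [mem_closedBall_zero_iff, not_le] at hx
    exact (le_max_left _ _).trans (Real.lt_sq_of_sqrt_lt hx).le
  · have hF (k : ℕ) (t : ℝ) : HasDerivAt (fun t => truncation (δ k) (U t) - U t)
        ((ramp (δ k) (U t) - 1) * deriv U t) t :=
      (((hasDerivAt_truncation _ _).comp t (hd t)).sub (hd t)).congr_deriv (by ring)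
    simp only [fun k => p.energy_radial (n := n) (hF k)]
    rw [← lintegral_zero (μ := riemVolume (n := n) p.metric)]
    refine tendsto_lintegral_of_dominated_convergence
      (fun x : Space n => ENNReal.ofReal (4 * ‖x‖ ^ 2 * deriv U (‖x‖ ^ 2) ^ 2)) (fun k => ?_)
      (fun k => Eventually.of_forall fun x => ?_) hfin.ne (Eventually.of_forall fun x => ?_)
    · have := continuous_ramp (δ k)
      have := hU.continuous
      exact ENNReal.measurable_ofReal.comp (Continuous.measurable (by fun_prop))
    · refine ENNReal.ofReal_le_ofReal ?_
      rw [mul_pow]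
      have h1 := ramp_nonneg (δ k) (U (‖x‖ ^ 2))
      have h2 := ramp_le_one (δ k) (U (‖x‖ ^ 2))
      have h3 : (ramp (δ k) (U (‖x‖ ^ 2)) - 1) ^ 2 ≤ 1 := by nlinarith
      have h4 : 0 ≤ 4 * ‖x‖ ^ 2 * deriv U (‖x‖ ^ 2) ^ 2 := by positivity
      nlinarith
    · refine tendsto_const_nhds.congr' ?_
      filter_upwards [hev x] with k hk
      simp [ramp_eq_one (hδ0 k) hk]
  · have h1 : Tendsto (fun k => 2 * δ k) atTop (𝓝 0) := by simpa using hδl.const_mul 2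
    refine tendsto_iff_norm_sub_tendsto_zero.2 (squeeze_zero' (Eventually.of_forall fun _ =>
      norm_nonneg _) ?_ h1)
    filter_upwards [hev x] with k hk
    exact abs_truncation_sub_le (hδ0 k) hk

end Profile

/-! ### The bent bubble: transition k and correction factor V -/

/-- A positive smooth function on the line which equals `1 + t` for `-1 / 2 ≤ t`. -/
def shift (t : ℝ) : ℝ := 1 + t * Real.smoothTransition (4 * t + 3)

theorem contDiff_shift : ContDiff ℝ ∞ shift :=
  contDiff_const.add (contDiff_id.mul (Real.smoothTransition.contDiff.comp (by fun_prop)))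

theorem shift_eq {t : ℝ} (ht : -1 / 2 ≤ t) : shift t = 1 + t := by
  rw [shift, Real.smoothTransition.one_of_one_le (by linarith), mul_one]

theorem shift_pos (t : ℝ) : 0 < shift t := by
  have h0 := Real.smoothTransition.nonneg (4 * t + 3)
  have h1 := Real.smoothTransition.le_one (4 * t + 3)
  rw [shift]
  rcases le_or_gt t (-3 / 4) with h | h
  · rw [Real.smoothTransition.zero_of_nonpos (by linarith)]
    norm_num
  · nlinarith

/-- The margin to the left of 0 makes the formulas for derivatives two-sided at the pole t = 0. -/
theorem hasDerivAt_shift {t : ℝ} (ht : -1 / 2 < t) : HasDerivAt shift 1 t := by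
  refine ((hasDerivAt_id t).const_add 1).congr_of_eventuallyEq ?_
  filter_upwards [Ioi_mem_nhds ht] with y hy
  exact shift_eq (le_of_lt hy)

/-- The exponents and the small constants that determine the solution and the metric. -/
structure Params where
  /-- The dimension. -/
  n : ℕ
  /-- The exponent of the equation. -/
  q : ℝ
  /-- The decay rate of the nonlinear term. -/
  s : ℝ
  /-- The speed of the transition between the two growth rates. -/
  σ : ℝ
  /-- The scale of the transition. -/
  ε : ℝ
  two_le_n : 2 ≤ n
  one_lt_q : 1 < q
  s_pos : 0 < s
  s_lt_one : s < 1
  σ_pos : 0 < σ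
  σ_le : σ ≤ s
  ε_pos : 0 < ε
  gap_pos : 0 < 2 * (1 + s) / (q - 1) + 2 - n
  σ_small : 2 * σ / (q - 1) + 2 * σ ^ 2 ≤ (2 * (1 + s) / (q - 1) + 2 - n) / 4
  ε_small : n * (4 * ε) ≤ (2 * (1 + s) / (q - 1) + 2 - n) / 2

namespace Params

variable (P : Params)

/-- The gap between the effective dimension at infinity and the dimension. -/
def gap : ℝ := 2 * (1 + P.s) / (P.q - 1) + 2 - P.n

/-- The small term that drives the transition. -/
def e (t : ℝ) : ℝ := P.ε * shift t ^ P.σ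

/-- The transition function, with values in `(0, 1)`. -/
def θ (t : ℝ) : ℝ := P.e t / (1 + P.e t)

/-- `(q - 1) / 2` times the logarithmic decay rate of the solution. -/
def k (t : ℝ) : ℝ := 2 - (1 - P.s) * P.θ t

/-- The logarithm of the correction factor. -/
def L (t : ℝ) : ℝ := (1 - P.s) / P.σ * (Real.log (1 + P.e t) - Real.log (1 + P.ε))

/-- The correction factor of the nonlinear term. -/
def V (t : ℝ) : ℝ := P.k 0 * Real.exp (P.L t) / P.k t

theorem e_pos (t : ℝ) : 0 < P.e t := mul_pos P.ε_pos (Real.rpow_pos_of_pos (shift_pos t) _)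

theorem θ_pos (t : ℝ) : 0 < P.θ t := div_pos (P.e_pos t) (by linarith [P.e_pos t])

theorem θ_lt_one (t : ℝ) : P.θ t < 1 := by
  rw [θ, div_lt_one (by linarith [P.e_pos t])]
  linarith

theorem lt_k (t : ℝ) : 1 + P.s < P.k t := by
  have := P.s_lt_one
  rw [k]
  nlinarith [P.θ_lt_one t]

theorem one_lt_k (t : ℝ) : 1 < P.k t := by linarith [P.lt_k t, P.s_pos]

theorem k_pos (t : ℝ) : 0 < P.k t := by linarith [P.one_lt_k t]

theorem k_lt_two (t : ℝ) : P.k t < 2 := by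
  have := P.s_lt_one
  rw [k]
  nlinarith [P.θ_pos t]

theorem e_zero : P.e 0 = P.ε := by
  rw [e, shift_eq (by norm_num), add_zero, Real.one_rpow, mul_one]

theorem L_zero : P.L 0 = 0 := by rw [L, e_zero, sub_self, mul_zero]

theorem V_zero : P.V 0 = 1 := by
  rw [V, L_zero, Real.exp_zero, mul_one, div_self (P.k_pos 0).ne']

theorem contDiff_e : ContDiff ℝ ∞ P.e :=
  contDiff_const.mul (contDiff_shift.rpow_const_of_ne fun t => (shift_pos t).ne')

theorem contDiff_θ : ContDiff ℝ ∞ P.θ :=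
  P.contDiff_e.div (contDiff_const.add P.contDiff_e) fun t => by linarith [P.e_pos t]

theorem contDiff_k : ContDiff ℝ ∞ P.k := contDiff_const.sub (contDiff_const.mul P.contDiff_θ)

theorem contDiff_L : ContDiff ℝ ∞ P.L :=
  contDiff_const.mul (((contDiff_const.add P.contDiff_e).log fun t => by
    linarith [P.e_pos t]).sub contDiff_const)

theorem contDiff_V : ContDiff ℝ ∞ P.V :=
  (contDiff_const.mul P.contDiff_L.exp).div P.contDiff_k fun t => (P.k_pos t).ne'

section Derivatives

variable {t : ℝ}

theorem hasDerivAt_e (ht : -1 / 2 < t) : HasDerivAt P.e (P.σ * P.e t / shift t) t := by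
  refine (((hasDerivAt_shift ht).rpow_const (p := P.σ) (Or.inl (shift_pos t).ne')).const_mul
    P.ε).congr_deriv ?_
  rw [Real.rpow_sub_one (shift_pos t).ne', e]
  ring

theorem hasDerivAt_θ (ht : -1 / 2 < t) :
    HasDerivAt P.θ (P.σ * (P.θ t * (1 - P.θ t) / shift t)) t := by
  have h1 : (1 + P.e t) ≠ 0 := by linarith [P.e_pos t]
  have h2 := (shift_pos t).ne'
  refine ((P.hasDerivAt_e ht).div ((P.hasDerivAt_e ht).const_add 1) h1).congr_deriv ?_
  rw [θ]
  field_simp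

theorem hasDerivAt_k (ht : -1 / 2 < t) :
    HasDerivAt P.k (-((1 - P.s) * P.σ * (P.θ t * (1 - P.θ t) / shift t))) t :=
  (((P.hasDerivAt_θ ht).const_mul (1 - P.s)).const_sub 2).congr_deriv (by ring)

theorem hasDerivAt_L (ht : -1 / 2 < t) : HasDerivAt P.L ((1 - P.s) * P.θ t / shift t) t := by
  have h1 : (1 + P.e t) ≠ 0 := by linarith [P.e_pos t]
  have h2 := (shift_pos t).ne'
  have h3 := P.σ_pos.ne'
  refine (((((P.hasDerivAt_e ht).const_add 1).log h1).sub_const _).const_mul _).congr_deriv ?_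
  rw [θ]
  field_simp

theorem hasDerivAt_V (ht : -1 / 2 < t) :
    HasDerivAt P.V (P.V t / shift t * ((1 - P.s) * P.θ t +
      P.σ * (1 - P.s) * (P.θ t * (1 - P.θ t)) / P.k t)) t := by
  have h1 := (P.k_pos t).ne'
  have h2 := (shift_pos t).ne'
  refine (((P.hasDerivAt_L ht).exp.const_mul (P.k 0)).div (P.hasDerivAt_k ht) h1).congr_deriv ?_
  rw [V]
  field_simp
  ring

end Derivatives

/-- For y = 1 + t ≥ 1 one has 1 + εy^σ ≤ (1 + ε)y^σ; raise this to the power (1 - s)/σ. -/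
theorem exp_L_le {t : ℝ} (ht : 0 ≤ t) : Real.exp (P.L t) ≤ (1 + t) ^ (1 - P.s) := by
  have hx : 0 < 1 + t := by linarith
  have h1 : 1 + P.e t ≤ (1 + P.ε) * (1 + t) ^ P.σ := by
    have : 1 ≤ (1 + t) ^ P.σ := Real.one_le_rpow (by linarith) P.σ_pos.le
    rw [e, shift_eq (by linarith)]
    linarith
  have h2 : Real.log (1 + P.e t) ≤ Real.log (1 + P.ε) + P.σ * Real.log (1 + t) := by
    rw [← Real.log_rpow hx, ← Real.log_mul (by linarith [P.ε_pos])
      (Real.rpow_pos_of_pos hx _).ne']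
    exact Real.log_le_log (by linarith [P.e_pos t]) h1
  rw [Real.rpow_def_of_pos hx]
  refine Real.exp_le_exp.2 ?_
  have h3 : 0 ≤ (1 - P.s) / P.σ := div_nonneg (by linarith [P.s_lt_one]) P.σ_pos.le
  calc P.L t ≤ (1 - P.s) / P.σ * (P.σ * Real.log (1 + t)) :=
        mul_le_mul_of_nonneg_left (by linarith) h3
    _ = Real.log (1 + t) * (1 - P.s) := by
        have := P.σ_pos.ne'
        field_simp

theorem V_pos (t : ℝ) : 0 < P.V t :=
  div_pos (mul_pos (P.k_pos 0) (Real.exp_pos _)) (P.k_pos t)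

theorem V_le {t : ℝ} (ht : 0 ≤ t) : P.V t ≤ 2 * (1 + t) ^ (1 - P.s) := by
  have h1 := P.exp_L_le ht
  have h2 := Real.exp_pos (P.L t)
  rw [V, div_le_iff₀ (P.k_pos t)]
  nlinarith [P.one_lt_k t, P.k_lt_two 0, P.k_pos 0]

theorem deriv_V_nonneg {t : ℝ} (ht : 0 ≤ t) : 0 ≤ deriv P.V t := by
  rw [(P.hasDerivAt_V (by linarith)).deriv]
  have := P.V_pos t
  have := shift_pos t
  have := P.s_lt_one
  have := P.θ_pos t
  have := P.θ_lt_one t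
  have := P.σ_pos
  have := P.k_pos t
  have h1 : 0 ≤ 1 - P.s := by linarith
  have h2 : 0 ≤ 1 - P.θ t := by linarith
  positivity

/-- V/(1+t) decays like (1+t)^{-s}, while θ ≤ ε(1+t)^σ; `σ_le` makes the product bounded by a
multiple of ε. -/
theorem deriv_V_le {t : ℝ} (ht : 0 ≤ t) : deriv P.V t ≤ 4 * P.ε := by
  rw [(P.hasDerivAt_V (by linarith)).deriv, shift_eq (by linarith)]
  have hx : 0 < 1 + t := by linarith
  have hs := P.s_pos
  have hs1 := P.s_lt_one
  have hθ := P.θ_pos t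
  have hθ1 := P.θ_lt_one t
  have hσ := P.σ_pos
  have hσ1 := P.σ_le
  have hk := P.one_lt_k t
  have h1 : P.θ t ≤ P.ε * (1 + t) ^ P.σ := by
    have := P.e_pos t
    rw [θ, ← shift_eq (by linarith : -1 / 2 ≤ t), ← e]
    exact div_le_self this.le (by linarith)
  have h2 : P.σ * (1 - P.s) * (P.θ t * (1 - P.θ t)) / P.k t ≤ P.θ t := by
    rw [div_le_iff₀ (by linarith)]
    have h3 : P.σ * (1 - P.s) ≤ 1 := by nlinarith
    have h4 : P.θ t * (1 - P.θ t) ≤ P.θ t := by nlinarith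
    have h5 : 0 ≤ P.θ t * (1 - P.θ t) := mul_nonneg hθ.le (by linarith)
    nlinarith
  have h3 : P.V t / (1 + t) ≤ 2 * (1 + t) ^ (-P.s) := by
    rw [div_le_iff₀ hx]
    refine (P.V_le ht).trans_eq ?_
    rw [mul_assoc, ← Real.rpow_add_one hx.ne']
    ring_nf
  calc P.V t / (1 + t) * ((1 - P.s) * P.θ t + P.σ * (1 - P.s) * (P.θ t * (1 - P.θ t)) / P.k t)
      ≤ 2 * (1 + t) ^ (-P.s) * (2 * (P.ε * (1 + t) ^ P.σ)) := by
        refine mul_le_mul h3 (by nlinarith) ?_ (by positivity)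
        have : 0 ≤ 1 - P.s := by linarith
        have : 0 ≤ 1 - P.θ t := by linarith
        positivity
    _ = 4 * P.ε * (1 + t) ^ (P.σ - P.s) := by
        rw [sub_eq_add_neg, Real.rpow_add hx]
        ring
    _ ≤ 4 * P.ε * 1 := by
        have := P.ε_pos
        gcongr
        exact Real.rpow_le_one_of_one_le_of_nonpos (by linarith) (by linarith)
    _ = 4 * P.ε := mul_one _

/-- The difference quotient of the correction factor. -/
def D (t : ℝ) : ℝ := dslope P.V 0 t

theorem contDiff_D : ContDiff ℝ ∞ P.D := contDiff_dslope_zero P.contDiff_V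

theorem mul_D (t : ℝ) : t * P.D t = P.V t - 1 := by
  have h := sub_smul_dslope P.V 0 t
  rwa [V_zero, sub_zero, smul_eq_mul] at h

theorem mul_deriv_D (t : ℝ) : t * deriv P.D t = deriv P.V t - P.D t := by
  have h := (hasDerivAt_id t).mul (P.contDiff_D.differentiable (by simp) t).hasDerivAt
  have h1 : id * P.D = fun t => P.V t - 1 := funext P.mul_D
  rw [h1] at h
  have h2 := h.unique ((P.contDiff_V.differentiable (by simp) t).hasDerivAt.sub_const 1)
  simp only [id_eq] at h2
  linarith

theorem exists_D_eq {t : ℝ} (ht : 0 ≤ t) : ∃ c, 0 ≤ c ∧ P.D t = deriv P.V c := by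
  rcases ht.eq_or_lt with rfl | h
  · exact ⟨0, le_rfl, dslope_same _ _⟩
  · obtain ⟨c, hc, hc'⟩ := exists_deriv_eq_slope P.V h P.contDiff_V.continuous.continuousOn
      (P.contDiff_V.differentiable (by simp)).differentiableOn
    refine ⟨c, hc.1.le, ?_⟩
    rw [hc', D, dslope_of_ne _ h.ne', slope_def_field]

theorem D_nonneg {t : ℝ} (ht : 0 ≤ t) : 0 ≤ P.D t := by
  obtain ⟨c, hc, h⟩ := P.exists_D_eq ht
  exact h ▸ P.deriv_V_nonneg hc

theorem D_le {t : ℝ} (ht : 0 ≤ t) : P.D t ≤ 4 * P.ε := by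
  obtain ⟨c, hc, h⟩ := P.exists_D_eq ht
  exact h ▸ P.deriv_V_le hc

/-- For t ≥ 1 this comes from tD = V - 1 and 1 + t ≤ 2t; for t ≤ 1 from the uniform bound 4ε, since
the power is at least 1/2 there. -/
theorem D_le_rpow {t : ℝ} (ht : 0 ≤ t) : P.D t ≤ (4 + 8 * P.ε) * (1 + t) ^ (-P.s) := by
  have hx : 0 < 1 + t := by linarith
  have hε := P.ε_pos
  have hp := Real.rpow_pos_of_pos hx (-P.s)
  rcases le_total t 1 with h | h
  · have h1 : (1 : ℝ) / 2 ≤ (1 + t) ^ (-P.s) := by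
      calc (1 : ℝ) / 2 ≤ (1 + t)⁻¹ := by
            rw [one_div]
            exact inv_anti₀ hx (by linarith)
        _ = (1 + t) ^ (-1 : ℝ) := (Real.rpow_neg_one _).symm
        _ ≤ _ := Real.rpow_le_rpow_of_exponent_le (by linarith) (by linarith [P.s_lt_one])
    nlinarith [P.D_le ht]
  · have h1 := P.mul_D t
    have h2 := P.V_le ht
    have h3 : (1 + t) ^ (1 - P.s) = (1 + t) ^ (-P.s) * (1 + t) := by
      rw [← Real.rpow_add_one hx.ne']
      ring_nf
    rw [h3] at h2
    have h4 : t * P.D t ≤ t * (4 * (1 + t) ^ (-P.s)) := by nlinarith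
    have := le_of_mul_le_mul_left h4 (by linarith)
    nlinarith

end Params

/-! ### The metric recovered from the solution, and its convexity -/

namespace Params

variable (P : Params)

/-- The primitive of `D / (1 + t)`. -/
def I (t : ℝ) : ℝ := ∫ y in (0 : ℝ)..t, P.D y / shift y

/-- The part of the logarithmic derivative of the metric without the nonlinear term. -/
def H (t : ℝ) : ℝ := 2 * P.k t / (P.q - 1) + 2 - P.n +
  2 * P.σ * (1 - P.s) * (P.θ t * (1 - P.θ t)) / P.k t

/-- The logarithm of the tangential factor of the metric. -/
def Λ (t : ℝ) : ℝ := (P.n * P.I t + (2 - P.n + 4 / (P.q - 1)) * Real.log (shift t) -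
  2 / (P.q - 1) * P.L t - 2 * (Real.log (P.k t) - Real.log (P.k 0))) / (P.n - 1)

/-- The solution as a function of the squared Euclidean distance to the pole. -/
def U (t : ℝ) : ℝ := Real.exp ((Real.log (2 * P.n * P.k 0 / (P.q - 1)) -
  2 * Real.log (shift t) + P.L t) / (P.q - 1))

theorem q_sub_one_pos : 0 < P.q - 1 := by linarith [P.one_lt_q]

theorem two_le_n_real : (2 : ℝ) ≤ P.n := by exact_mod_cast P.two_le_n

theorem n_sub_one_pos : (0 : ℝ) < P.n - 1 := by linarith [P.two_le_n_real]

theorem contDiff_D_div_shift : ContDiff ℝ ∞ fun t => P.D t / shift t :=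
  P.contDiff_D.div contDiff_shift fun t => (shift_pos t).ne'

theorem hasDerivAt_I (t : ℝ) : HasDerivAt P.I (P.D t / shift t) t :=
  have hc := P.contDiff_D_div_shift.continuous
  intervalIntegral.integral_hasDerivAt_right (hc.intervalIntegrable _ _)
    hc.aestronglyMeasurable.stronglyMeasurableAtFilter hc.continuousAt

theorem contDiff_I : ContDiff ℝ ∞ P.I := by
  refine contDiff_infty_iff_deriv.2 ⟨fun t => (P.hasDerivAt_I t).differentiableAt, ?_⟩
  rw [funext fun t => (P.hasDerivAt_I t).deriv]
  exact P.contDiff_D_div_shift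

theorem contDiff_log_shift : ContDiff ℝ ∞ fun t => Real.log (shift t) :=
  contDiff_shift.log fun t => (shift_pos t).ne'

theorem contDiff_Λ : ContDiff ℝ ∞ P.Λ :=
  ((((contDiff_const.mul P.contDiff_I).add (contDiff_const.mul contDiff_log_shift)).sub
    (contDiff_const.mul P.contDiff_L)).sub (contDiff_const.mul
      ((P.contDiff_k.log fun t => (P.k_pos t).ne').sub contDiff_const))).div_const _

theorem contDiff_U : ContDiff ℝ ∞ P.U :=
  (((contDiff_const.sub (contDiff_const.mul contDiff_log_shift)).add
    P.contDiff_L).div_const _).exp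

theorem Λ_zero : P.Λ 0 = 0 := by
  rw [Λ, I, intervalIntegral.integral_same, L_zero, shift_eq (by norm_num)]
  simp

theorem U_pos (t : ℝ) : 0 < P.U t := Real.exp_pos _

section Derivatives

variable {t : ℝ}

theorem hasDerivAt_log_shift (ht : -1 / 2 < t) :
    HasDerivAt (fun t => Real.log (shift t)) (1 / shift t) t :=
  (hasDerivAt_shift ht).log (shift_pos t).ne'

theorem hasDerivAt_Λ (ht : -1 / 2 < t) :
    HasDerivAt P.Λ ((P.n * P.D t + P.H t) / ((P.n - 1) * shift t)) t := by
  have h1 := P.n_sub_one_pos.ne'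
  have h2 := P.q_sub_one_pos.ne'
  have h3 := (shift_pos t).ne'
  have h4 := (P.k_pos t).ne'
  refine ((((((P.hasDerivAt_I t).const_mul (P.n : ℝ)).add
    ((hasDerivAt_log_shift ht).const_mul (2 - P.n + 4 / (P.q - 1)))).sub
    ((P.hasDerivAt_L ht).const_mul (2 / (P.q - 1)))).sub
    ((((P.hasDerivAt_k ht).log h4).sub_const _).const_mul 2)).div_const _).congr_deriv ?_
  have hk : 2 * P.k t / (P.q - 1) = 4 / (P.q - 1) - 2 / (P.q - 1) * ((1 - P.s) * P.θ t) := by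
    rw [k]
    ring
  rw [H, hk]
  field_simp
  ring

theorem hasDerivAt_H (ht : -1 / 2 < t) : HasDerivAt P.H
    ((1 - P.s) * (P.θ t * (1 - P.θ t) / shift t) *
    (2 * P.σ ^ 2 * ((1 - 2 * P.θ t) / P.k t + (1 - P.s) * (P.θ t * (1 - P.θ t)) / P.k t ^ 2) -
      2 * P.σ / (P.q - 1))) t := by
  have h2 := P.q_sub_one_pos.ne'
  have h3 := (shift_pos t).ne'
  have h4 := (P.k_pos t).ne'
  refine ((((((P.hasDerivAt_k ht).const_mul 2).div_const (P.q - 1)).add_const 2).sub_const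
    (P.n : ℝ)).add ((((P.hasDerivAt_θ ht).mul ((P.hasDerivAt_θ ht).const_sub 1)).const_mul
      (2 * P.σ * (1 - P.s))).div (P.hasDerivAt_k ht) h4)).congr_deriv ?_
  simp only [Pi.mul_apply]
  field_simp
  ring

theorem hasDerivAt_U (ht : -1 / 2 < t) :
    HasDerivAt P.U (-(P.U t * (P.k t / ((P.q - 1) * shift t)))) t := by
  have h2 := P.q_sub_one_pos.ne'
  have h3 := (shift_pos t).ne'
  have h : HasDerivAt (fun t => (Real.log (2 * P.n * P.k 0 / (P.q - 1)) -
      2 * Real.log (shift t) + P.L t) / (P.q - 1)) (-(P.k t / ((P.q - 1) * shift t))) t := by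
    refine (((((hasDerivAt_log_shift ht).const_mul 2).const_sub _).add
      (P.hasDerivAt_L ht)).div_const (P.q - 1)).congr_deriv ?_
    rw [k]
    field_simp
    ring
  exact h.exp.congr_deriv (by rw [U]; ring)

theorem hasDerivAt_deriv_U (ht : -1 / 2 < t) :
    HasDerivAt (deriv P.U) (P.U t * (P.k t / ((P.q - 1) * shift t)) *
      (P.k t / ((P.q - 1) * shift t) + (1 - P.s) * P.σ * (P.θ t * (1 - P.θ t)) / (P.k t * shift t) +
        1 / shift t)) t := by
  have h2 := P.q_sub_one_pos.ne'
  have h3 := (shift_pos t).ne'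
  have h4 := (P.k_pos t).ne'
  have h5 := ((P.hasDerivAt_U ht).mul ((P.hasDerivAt_k ht).div
    ((hasDerivAt_shift ht).const_mul (P.q - 1)) (mul_ne_zero h2 h3))).neg
  refine (h5.congr_of_eventuallyEq ?_).congr_deriv ?_
  · filter_upwards [Ioi_mem_nhds ht] with y hy
    exact (P.hasDerivAt_U hy).deriv
  · simp only [Pi.div_apply]
    field_simp
    ring

theorem hasDerivAt_deriv_Λ (ht : -1 / 2 < t) : HasDerivAt (deriv P.Λ)
    ((P.n * deriv P.D t + deriv P.H t) / ((P.n - 1) * shift t) -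
      (P.n * P.D t + P.H t) / ((P.n - 1) * shift t ^ 2)) t := by
  have h1 := P.n_sub_one_pos.ne'
  have h3 := (shift_pos t).ne'
  have hH : HasDerivAt P.H (deriv P.H t) t := (P.hasDerivAt_H ht).differentiableAt.hasDerivAt
  have hD : HasDerivAt P.D (deriv P.D t) t :=
    (P.contDiff_D.differentiable (by simp) t).hasDerivAt
  have h5 := ((hD.const_mul (P.n : ℝ)).add hH).div
    ((hasDerivAt_shift ht).const_mul (P.n - 1 : ℝ)) (mul_ne_zero h1 h3)
  refine (h5.congr_of_eventuallyEq ?_).congr_deriv ?_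
  · filter_upwards [Ioi_mem_nhds ht] with y hy
    exact (P.hasDerivAt_Λ hy).deriv
  · simp only [Pi.add_apply]
    field_simp

end Derivatives

/-- The constant in `U` is fixed by the equation at t = 0, where the term with Λ' drops out; this is
why V(0) = 1. -/
theorem U_rpow {t : ℝ} (ht : 0 ≤ t) : P.U t ^ P.q =
    P.U t * (2 * P.n / (P.q - 1) * (P.V t * P.k t) / (1 + t) ^ 2) := by
  have hx : 0 < 1 + t := by linarith
  have hq := P.q_sub_one_pos
  have hn := P.two_le_n_real
  have hc : 0 < 2 * P.n * P.k 0 / (P.q - 1) :=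
    div_pos (mul_pos (by linarith) (P.k_pos 0)) hq
  have hk := (P.k_pos t).ne'
  have h1 : P.U t ^ (P.q - 1) = 2 * P.n / (P.q - 1) * (P.V t * P.k t) / (1 + t) ^ 2 := by
    rw [U, ← Real.exp_mul, div_mul_cancel₀ _ hq.ne', Real.exp_add, Real.exp_sub, Real.exp_log hc,
      shift_eq (by linarith), V]
    rw [show 2 * Real.log (1 + t) = Real.log (1 + t) + Real.log (1 + t) by ring, Real.exp_add,
      Real.exp_log hx]
    field_simp
  rw [← h1, ← Real.rpow_one_add' (P.U_pos t).le (by linarith [P.one_lt_q])]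
  ring_nf

/-- Λ was defined by solving this identity for Λ'; substituting V = 1 + tD leaves algebra. -/
theorem ode {t : ℝ} (ht : 0 ≤ t) : -(4 * t * deriv (deriv P.U) t +
    (2 * P.n + 2 * (P.n - 1) * t * deriv P.Λ t) * deriv P.U t) = P.U t ^ P.q := by
  have ht' : -1 / 2 < t := by linarith
  have hx : 1 + t ≠ 0 := by linarith
  have hq := P.q_sub_one_pos.ne'
  have hn := P.n_sub_one_pos.ne'
  have hk := (P.k_pos t).ne'
  rw [(P.hasDerivAt_deriv_U ht').deriv, (P.hasDerivAt_Λ ht').deriv, (P.hasDerivAt_U ht').deriv,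
    P.U_rpow ht, shift_eq ht'.le]
  have h1 : P.V t = 1 + t * P.D t := by linarith [P.mul_D t]
  rw [h1, H]
  field_simp
  ring

theorem gap_le_H (t : ℝ) : P.gap ≤ P.H t := by
  have hq := P.q_sub_one_pos
  have h1 : 2 * (1 + P.s) / (P.q - 1) ≤ 2 * P.k t / (P.q - 1) := by
    gcongr
    exact (P.lt_k t).le
  have h2 : 0 ≤ 2 * P.σ * (1 - P.s) * (P.θ t * (1 - P.θ t)) / P.k t := by
    have := P.σ_pos
    have := P.k_pos t
    have := P.θ_pos t
    have : 0 ≤ 1 - P.s := by linarith [P.s_lt_one]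
    have : 0 ≤ 1 - P.θ t := by linarith [P.θ_lt_one t]
    positivity
  rw [gap, H]
  linarith

/-- H depends on t only through θ, which moves at speed σ in log(1+t). Hence tH' is a weight in [0,
1] times a quantity at least -(2σ/(q-1) + 2σ²), which `σ_small` bounds. -/
theorem neg_gap_le_mul_deriv_H {t : ℝ} (ht : 0 ≤ t) : -(P.gap / 4) ≤ t * deriv P.H t := by
  have hx : 0 < 1 + t := by linarith
  have hq := P.q_sub_one_pos
  have hσ := P.σ_pos
  have hs := P.s_pos
  have hs1 := P.s_lt_one
  have hθ := P.θ_pos t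
  have hθ1 := P.θ_lt_one t
  have hk := P.one_lt_k t
  have hs2 : 0 ≤ 1 - P.s := by linarith
  have hθ2 : 0 ≤ 1 - P.θ t := by linarith
  rw [(P.hasDerivAt_H (by linarith)).deriv, shift_eq (by linarith)]
  set w := t * ((1 - P.s) * (P.θ t * (1 - P.θ t) / (1 + t))) with hw
  have hw0 : 0 ≤ w := by positivity
  have hw1 : w ≤ 1 := by
    have h1 : w = (1 - P.s) * (P.θ t * (1 - P.θ t)) * (t / (1 + t)) := by
      rw [hw]
      ring
    have h2 : t / (1 + t) ≤ 1 := by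
      rw [div_le_one hx]
      linarith
    have h3 : P.θ t * (1 - P.θ t) ≤ 1 := by nlinarith
    have h4 : (1 - P.s) * (P.θ t * (1 - P.θ t)) ≤ 1 :=
      mul_le_one₀ (by linarith) (by positivity) h3
    rw [h1]
    exact mul_le_one₀ h4 (by positivity) h2
  have h1 : -1 ≤ (1 - 2 * P.θ t) / P.k t := by
    rw [le_div_iff₀ (by linarith)]
    linarith
  have h2 : 0 ≤ (1 - P.s) * (P.θ t * (1 - P.θ t)) / P.k t ^ 2 := by positivity
  set c := 2 * P.σ ^ 2 * ((1 - 2 * P.θ t) / P.k t +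
    (1 - P.s) * (P.θ t * (1 - P.θ t)) / P.k t ^ 2) - 2 * P.σ / (P.q - 1) with hc
  have h3 : -(P.gap / 4) ≤ c := by
    have h4 := P.σ_small
    have h5 : -(2 * P.σ ^ 2) ≤ 2 * P.σ ^ 2 * ((1 - 2 * P.θ t) / P.k t +
        (1 - P.s) * (P.θ t * (1 - P.θ t)) / P.k t ^ 2) := by
      nlinarith [sq_nonneg P.σ]
    rw [gap, hc]
    linarith
  have h4 : 0 < P.gap := P.gap_pos
  rw [show t * ((1 - P.s) * (P.θ t * (1 - P.θ t) / (1 + t)) * c) = w * c by rw [hw]; ring]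
  nlinarith

theorem deriv_Λ_nonneg {t : ℝ} (ht : 0 ≤ t) : 0 ≤ deriv P.Λ t := by
  rw [(P.hasDerivAt_Λ (by linarith)).deriv]
  have := P.D_nonneg ht
  have := (P.gap_pos.trans_le (P.gap_le_H t)).le
  have := P.n_sub_one_pos
  have := shift_pos t
  positivity

/-- Up to a positive factor and nonnegative terms the expression is H - nD + 2tH', because tD' = V'
- D with V' ≥ 0. Here H ≥ gap, and nD and -2tH' cost at most half of the gap each. -/
theorem convexity {t : ℝ} (ht : 0 ≤ t) :
    0 ≤ 3 * deriv P.Λ t + 2 * t * deriv (deriv P.Λ) t := by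
  have ht' : -1 / 2 < t := by linarith
  have hx : 0 < 1 + t := by linarith
  have hn := P.n_sub_one_pos
  rw [(P.hasDerivAt_deriv_Λ ht').deriv, (P.hasDerivAt_Λ ht').deriv, shift_eq ht'.le]
  have h1 := P.mul_deriv_D t
  have h2 := P.deriv_V_nonneg ht
  have h3 := P.D_nonneg ht
  have h4 := P.neg_gap_le_mul_deriv_H ht
  have h5 := P.gap_le_H t
  have h6 : P.n * P.D t ≤ P.gap / 2 :=
    (mul_le_mul_of_nonneg_left (P.D_le ht) (Nat.cast_nonneg _)).trans P.ε_small
  have h7 : 0 < P.gap := P.gap_pos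
  have h8 : (P.n : ℝ) * (t * deriv P.D t) = P.n * (deriv P.V t - P.D t) := by rw [h1]
  have h9 : 0 ≤ P.n * deriv P.V t := mul_nonneg (Nat.cast_nonneg _) h2
  have h10 : 0 ≤ P.n * P.D t := mul_nonneg (Nat.cast_nonneg _) h3
  have key : 3 * ((P.n * P.D t + P.H t) / ((P.n - 1) * (1 + t))) +
      2 * t * ((P.n * deriv P.D t + deriv P.H t) / ((P.n - 1) * (1 + t)) -
        (P.n * P.D t + P.H t) / ((P.n - 1) * (1 + t) ^ 2)) =
      ((P.n * P.D t + P.H t) * (1 + 2 / (1 + t)) +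
        2 * (P.n * (t * deriv P.D t) + t * deriv P.H t)) / ((P.n - 1) * (1 + t)) := by
    field_simp
    ring
  rw [key]
  refine div_nonneg ?_ (mul_pos hn hx).le
  have h11 : 0 ≤ (P.n * P.D t + P.H t) * (2 / (1 + t)) :=
    mul_nonneg (by linarith) (by positivity)
  rw [h8]
  linarith

/-- The metric of the construction. -/
def profile : Profile where
  toFun := P.Λ
  smooth := P.contDiff_Λ
  map_zero := P.Λ_zero
  nonneg t ht := by
    have h := monotoneOn_of_deriv_nonneg (convex_Ici 0) P.contDiff_Λ.continuous.continuousOn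
      (P.contDiff_Λ.differentiable (by simp)).differentiableOn
      (fun x hx => P.deriv_Λ_nonneg (by rw [interior_Ici] at hx; exact le_of_lt hx))
    rw [← P.Λ_zero]
    exact h self_mem_Ici ht ht

end Params

/-! ### Behaviour at infinity and the choice of constants -/

namespace Params

variable (P : Params)

/-- Here s > 0 is essential: convergence of this integral lets Λ minus its logarithm have a limit,
hence gives ψ' a true constant κ. -/
theorem integrableOn_D_div_shift : IntegrableOn (fun t => P.D t / shift t) (Ioi 0) := by
  have h1 : IntegrableOn (fun t : ℝ => (4 + 8 * P.ε) * (t + 1) ^ (-P.s - 1)) (Ioi 0) :=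
    (integrableOn_add_rpow_Ioi_of_lt (by linarith [P.s_pos]) (by norm_num)).const_mul _
  refine Integrable.mono' h1 P.contDiff_D_div_shift.continuous.aestronglyMeasurable ?_
  refine (ae_restrict_iff' measurableSet_Ioi).2 (Eventually.of_forall fun t (ht : 0 < t) => ?_)
  have hx : 0 < 1 + t := by linarith
  rw [shift_eq (by linarith), Real.norm_of_nonneg (div_nonneg (P.D_nonneg ht.le) hx.le),
    div_le_iff₀ hx, add_comm t 1, mul_assoc, ← Real.rpow_add_one hx.ne', sub_add_cancel]
  exact P.D_le_rpow ht.le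

/-- The limit of `I` at infinity. -/
def totalI : ℝ := ∫ t in Ioi (0 : ℝ), P.D t / shift t

theorem tendsto_I : Tendsto P.I atTop (𝓝 P.totalI) :=
  intervalIntegral_tendsto_integral_Ioi 0 P.integrableOn_D_div_shift tendsto_id

theorem I_le {t : ℝ} (ht : 0 ≤ t) : P.I t ≤ P.totalI := by
  rw [I, intervalIntegral.integral_of_le ht]
  refine setIntegral_mono_set P.integrableOn_D_div_shift ?_ Ioc_subset_Ioi_self.eventuallyLE
  exact (ae_restrict_iff' measurableSet_Ioi).2 (Eventually.of_forall fun y (hy : 0 < y) =>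
    div_nonneg (P.D_nonneg hy.le) (shift_pos y).le)

theorem L_le {t : ℝ} (ht : 0 ≤ t) : P.L t ≤ (1 - P.s) * Real.log (1 + t) := by
  have hx : 0 < 1 + t := by linarith
  rw [← Real.exp_le_exp]
  refine (P.exp_L_le ht).trans_eq ?_
  rw [Real.rpow_def_of_pos hx, mul_comm]

theorem tendsto_log_one_add : Tendsto (fun t : ℝ => Real.log (1 + t)) atTop atTop :=
  Real.tendsto_log_atTop.comp (tendsto_atTop_add_const_left _ _ tendsto_id)

theorem tendsto_U : Tendsto P.U atTop (𝓝 0) := by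
  have hq := P.q_sub_one_pos
  have hs : 0 < (1 + P.s) / (P.q - 1) := div_pos (by linarith [P.s_pos]) hq
  have h1 : Tendsto (fun t : ℝ => Real.exp (Real.log (2 * P.n * P.k 0 / (P.q - 1)) / (P.q - 1) +
      -((1 + P.s) / (P.q - 1) * Real.log (1 + t)))) atTop (𝓝 0) :=
    Real.tendsto_exp_atBot.comp (tendsto_atBot_add_const_left _ _
      (tendsto_neg_atTop_atBot.comp (tendsto_log_one_add.const_mul_atTop hs)))
  refine squeeze_zero' (Eventually.of_forall fun t => (P.U_pos t).le) ?_ h1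
  filter_upwards [eventually_ge_atTop 0] with t ht
  rw [U, shift_eq (by linarith)]
  refine Real.exp_le_exp.2 ?_
  have h2 := P.L_le ht
  calc _ ≤ (Real.log (2 * P.n * P.k 0 / (P.q - 1)) - 2 * Real.log (1 + t) +
        (1 - P.s) * Real.log (1 + t)) / (P.q - 1) := by gcongr
    _ = _ := by ring

/-- L enters U² with coefficient 2/(q-1) and the volume density with -1/(q-1); the remaining L is at
most (1-s)log(1+t). The resulting exponent beats the dimension by 2(1+s)/(q-1). -/
theorem energy_bound {t : ℝ} (ht : 0 ≤ t) :
    4 * t * deriv P.U t ^ 2 * Real.exp ((P.n - 1 : ℝ) / 2 * P.Λ t) ≤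
      16 / (P.q - 1) ^ 2 * Real.exp (2 * Real.log (2 * P.n * P.k 0 / (P.q - 1)) / (P.q - 1) +
        P.n * P.totalI / 2 + Real.log (P.k 0)) *
      (1 + t) ^ (-(P.n + 2 * (1 + P.s) / (P.q - 1)) / 2) := by
  have hx : 0 < 1 + t := by linarith
  have hq := P.q_sub_one_pos
  have hn := P.n_sub_one_pos
  have hk := P.one_lt_k t
  have hk2 := P.k_lt_two t
  rw [(P.hasDerivAt_U (by linarith)).deriv, neg_sq, mul_pow, shift_eq (by linarith)]
  have h1 : 4 * t * (P.k t / ((P.q - 1) * (1 + t))) ^ 2 ≤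
      16 / (P.q - 1) ^ 2 * Real.exp (-Real.log (1 + t)) := by
    rw [Real.exp_neg, Real.exp_log hx, div_pow, mul_pow]
    have h2 : P.k t ^ 2 ≤ 4 := by nlinarith
    calc 4 * t * (P.k t ^ 2 / ((P.q - 1) ^ 2 * (1 + t) ^ 2))
        ≤ 4 * (1 + t) * (4 / ((P.q - 1) ^ 2 * (1 + t) ^ 2)) := by gcongr; linarith
      _ = _ := by
        field_simp
        norm_num
  have h2 : P.U t ^ 2 * Real.exp ((P.n - 1 : ℝ) / 2 * P.Λ t) ≤
      Real.exp (2 * Real.log (2 * P.n * P.k 0 / (P.q - 1)) / (P.q - 1) +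
        P.n * P.totalI / 2 + Real.log (P.k 0) +
        Real.log (1 + t) * (1 - P.n / 2 - (1 + P.s) / (P.q - 1))) := by
    rw [U, ← Real.exp_nat_mul, ← Real.exp_add]
    refine Real.exp_le_exp.2 ?_
    have h3 : 0 ≤ Real.log (P.k t) := Real.log_nonneg hk.le
    have h4 : P.n * P.I t ≤ P.n * P.totalI :=
      mul_le_mul_of_nonneg_left (P.I_le ht) (Nat.cast_nonneg _)
    have h5 : P.L t / (P.q - 1) ≤ (1 - P.s) * Real.log (1 + t) / (P.q - 1) := by
      gcongr
      exact P.L_le ht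
    rw [Λ, shift_eq (by linarith)]
    have h6 : (P.n - 1 : ℝ) / 2 * ((P.n * P.I t + (2 - P.n + 4 / (P.q - 1)) * Real.log (1 + t) -
        2 / (P.q - 1) * P.L t - 2 * (Real.log (P.k t) - Real.log (P.k 0))) / (P.n - 1)) =
        (P.n * P.I t + (2 - P.n + 4 / (P.q - 1)) * Real.log (1 + t)) / 2 -
        P.L t / (P.q - 1) - (Real.log (P.k t) - Real.log (P.k 0)) := by
      field_simp
    rw [h6]
    push_cast
    calc _ = 2 * Real.log (2 * P.n * P.k 0 / (P.q - 1)) / (P.q - 1) + P.n * P.I t / 2 +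
          Real.log (P.k 0) - Real.log (P.k t) + P.L t / (P.q - 1) +
          Real.log (1 + t) * (1 - P.n / 2 - 2 / (P.q - 1)) := by ring
      _ ≤ 2 * Real.log (2 * P.n * P.k 0 / (P.q - 1)) / (P.q - 1) + P.n * P.totalI / 2 +
          Real.log (P.k 0) + (1 - P.s) * Real.log (1 + t) / (P.q - 1) +
          Real.log (1 + t) * (1 - P.n / 2 - 2 / (P.q - 1)) := by linarith
      _ = _ := by ring
  have h7 : (1 + t) ^ (-(P.n + 2 * (1 + P.s) / (P.q - 1)) / 2) =
      Real.exp (-Real.log (1 + t)) *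
        Real.exp (Real.log (1 + t) * (1 - P.n / 2 - (1 + P.s) / (P.q - 1))) := by
    rw [Real.rpow_def_of_pos hx, ← Real.exp_add]
    ring_nf
  rw [Real.exp_add] at h2
  calc _ = (4 * t * (P.k t / ((P.q - 1) * (1 + t))) ^ 2) *
        (P.U t ^ 2 * Real.exp ((P.n - 1 : ℝ) / 2 * P.Λ t)) := by ring
    _ ≤ _ := mul_le_mul h1 h2 (by positivity) (by positivity)
    _ = _ := by
      rw [h7]
      ring

theorem tendsto_e : Tendsto P.e atTop atTop := by
  have h1 : Tendsto (fun t : ℝ => P.ε * (1 + t) ^ P.σ) atTop atTop :=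
    ((tendsto_rpow_atTop P.σ_pos).comp
      (tendsto_atTop_add_const_left _ _ tendsto_id)).const_mul_atTop P.ε_pos
  refine h1.congr' ?_
  filter_upwards [eventually_ge_atTop 0] with t ht
  rw [e, shift_eq (by linarith)]

theorem tendsto_θ : Tendsto P.θ atTop (𝓝 1) := by
  have h1 : Tendsto (fun t => 1 - (1 + P.e t)⁻¹) atTop (𝓝 (1 - 0)) :=
    tendsto_const_nhds.sub (tendsto_inv_atTop_zero.comp
      (tendsto_atTop_add_const_left _ _ P.tendsto_e))
  rw [sub_zero] at h1
  refine h1.congr fun t => ?_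
  have : 1 + P.e t ≠ 0 := by linarith [P.e_pos t]
  rw [θ]
  field_simp
  ring

theorem tendsto_k : Tendsto P.k atTop (𝓝 (1 + P.s)) := by
  have h := (P.tendsto_θ.const_mul (1 - P.s)).const_sub 2
  rwa [show 2 - (1 - P.s) * 1 = 1 + P.s by ring] at h

theorem tendsto_H : Tendsto P.H atTop (𝓝 P.gap) := by
  have hs : 1 + P.s ≠ 0 := by linarith [P.s_pos]
  have h := (((P.tendsto_k.const_mul 2).div_const (P.q - 1)).add_const 2).sub_const (P.n : ℝ) |>.add
    (((P.tendsto_θ.mul (P.tendsto_θ.const_sub 1)).const_mul (2 * P.σ * (1 - P.s))).div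
      P.tendsto_k hs)
  rw [sub_self, mul_zero, mul_zero, zero_div, add_zero] at h
  exact h

theorem tendsto_D : Tendsto P.D atTop (𝓝 0) := by
  have h1 : Tendsto (fun t : ℝ => (4 + 8 * P.ε) * (1 + t) ^ (-P.s)) atTop (𝓝 0) := by
    simpa using ((tendsto_rpow_neg_atTop P.s_pos).comp
      (tendsto_atTop_add_const_left _ (1 : ℝ) tendsto_id)).const_mul (4 + 8 * P.ε)
  refine squeeze_zero' ?_ ?_ h1
  · filter_upwards [eventually_ge_atTop 0] with t ht using P.D_nonneg ht
  · filter_upwards [eventually_ge_atTop 0] with t ht using P.D_le_rpow ht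

theorem tendsto_mul_deriv_Λ :
    Tendsto (fun t => t * deriv P.Λ t) atTop (𝓝 (P.gap / (P.n - 1))) := by
  have h1 : Tendsto (fun t : ℝ => 1 - (1 + t)⁻¹) atTop (𝓝 (1 - 0)) :=
    tendsto_const_nhds.sub (tendsto_inv_atTop_zero.comp
      (tendsto_atTop_add_const_left _ _ tendsto_id))
  have h2 := h1.mul (((P.tendsto_D.const_mul (P.n : ℝ)).add P.tendsto_H).div_const (P.n - 1 : ℝ))
  rw [sub_zero, one_mul, mul_zero, zero_add] at h2
  refine h2.congr' ?_
  filter_upwards [eventually_ge_atTop 0] with t ht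
  have hn := P.n_sub_one_pos.ne'
  have hx : 1 + t ≠ 0 := by linarith
  rw [(P.hasDerivAt_Λ (by linarith)).deriv, shift_eq (by linarith)]
  field_simp
  ring

theorem tendsto_L_sub : Tendsto (fun t => P.L t - (1 - P.s) * Real.log (1 + t)) atTop
    (𝓝 ((1 - P.s) / P.σ * (Real.log P.ε - Real.log (1 + P.ε)))) := by
  have h1 : Tendsto (fun t => Real.log (1 + (P.e t)⁻¹)) atTop (𝓝 0) := by
    have := (((tendsto_inv_atTop_zero.comp P.tendsto_e).const_add 1).log (by norm_num))
    simpa using this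
  have h2 := ((h1.const_add (Real.log P.ε)).sub_const (Real.log (1 + P.ε))).const_mul
    ((1 - P.s) / P.σ)
  rw [add_zero] at h2
  refine h2.congr' ?_
  filter_upwards [eventually_ge_atTop 0] with t ht
  have hx : 0 < 1 + t := by linarith
  have he := P.e_pos t
  have hσ := P.σ_pos.ne'
  have h3 : Real.log (1 + P.e t) =
      Real.log P.ε + P.σ * Real.log (1 + t) + Real.log (1 + (P.e t)⁻¹) := by
    rw [← Real.log_rpow hx, ← Real.log_mul P.ε_pos.ne' (Real.rpow_pos_of_pos hx _).ne',
      ← shift_eq (by linarith : -1 / 2 ≤ t), ← e, ← Real.log_mul he.ne' (by positivity)]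
    congr 1
    field_simp
    ring
  rw [L, h3]
  field_simp
  ring

/-- The logarithms add up to gap/(n-1), since 4/(q-1) - 2(1-s)/(q-1) = 2(1+s)/(q-1); every other
term converges. -/
theorem exists_tendsto_Λ_sub :
    ∃ c, Tendsto (fun t => P.Λ t - P.gap / (P.n - 1) * Real.log t) atTop (𝓝 c) := by
  have hs : 1 + P.s ≠ 0 := by linarith [P.s_pos]
  have h1 : Tendsto (fun t : ℝ => Real.log (1 + t) - Real.log t) atTop (𝓝 0) := by
    have h : Tendsto (fun t : ℝ => Real.log (1 + t⁻¹)) atTop (𝓝 0) := by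
      simpa using (tendsto_inv_atTop_zero.const_add (1 : ℝ)).log (by norm_num)
    refine h.congr' ?_
    filter_upwards [eventually_gt_atTop 0] with t ht
    rw [← Real.log_div (by linarith) ht.ne']
    congr 1
    field_simp
    ring
  have h2 := (((P.tendsto_I.const_mul (P.n : ℝ)).sub (P.tendsto_L_sub.const_mul
    (2 / (P.q - 1)))).sub (((P.tendsto_k.log hs).sub_const
      (Real.log (P.k 0))).const_mul 2)).div_const (P.n - 1 : ℝ) |>.add
      (h1.const_mul (P.gap / (P.n - 1)))
  refine ⟨_, h2.congr' ?_⟩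
  filter_upwards [eventually_ge_atTop 0] with t ht
  have hn := P.n_sub_one_pos.ne'
  have hq := P.q_sub_one_pos.ne'
  rw [Λ, shift_eq (by linarith), gap]
  field_simp
  ring

theorem exists_isEquivalent_deriv_model : ∃ κ : ℝ, 0 < κ ∧
    (deriv P.profile.model ~[atTop] fun r : ℝ => κ * (P.gap / (P.n - 1) + 1) *
      r ^ (P.gap / (P.n - 1))) := by
  obtain ⟨c, hc⟩ := P.exists_tendsto_Λ_sub
  have hβ : 0 < P.gap / (P.n - 1) := div_pos P.gap_pos P.n_sub_one_pos
  have hβ1 : P.gap / (P.n - 1) + 1 ≠ 0 := by linarith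
  have hr : Tendsto (fun r : ℝ => r ^ 2) atTop atTop := tendsto_pow_atTop two_ne_zero
  -- As ψ' = e^{Λ/2}(1 + tΛ') at t = r², the limit c of Λ - β log t, with β = gap/(n-1), gives ψ' ~
  -- e^{c/2}(1 + β)r^β.
  refine ⟨Real.exp (c / 2), Real.exp_pos _, ?_⟩
  refine (isEquivalent_iff_tendsto_one ?_).2 ?_
  · filter_upwards [eventually_gt_atTop 0] with r hr
    have := Real.rpow_pos_of_pos hr (P.gap / (P.n - 1))
    have := Real.exp_pos (c / 2)
    positivity
  · have h1 := (((hc.comp hr).div_const 2).rexp.mul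
      ((P.tendsto_mul_deriv_Λ.comp hr).const_add 1)).div_const
        (Real.exp (c / 2) * (P.gap / (P.n - 1) + 1))
    rw [add_comm 1, div_self (mul_ne_zero (Real.exp_pos _).ne' hβ1)] at h1
    refine h1.congr' ?_
    filter_upwards [eventually_gt_atTop 0] with r hr
    rw [Pi.div_apply, (P.profile.hasDerivAt_model r).deriv, Real.rpow_def_of_pos hr]
    have h2 : Real.exp ((P.Λ (r ^ 2) - P.gap / (P.n - 1) * Real.log (r ^ 2)) / 2) =
        Real.exp (P.Λ (r ^ 2) / 2) / Real.exp (Real.log r * (P.gap / (P.n - 1))) := by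
      rw [← Real.exp_sub, Real.log_pow]
      congr 1
      push_cast
      ring
    simp only [Function.comp_apply, h2]
    change _ = Real.exp (P.Λ (r ^ 2) / 2) * (1 + r ^ 2 * deriv P.Λ (r ^ 2)) / _
    field_simp

theorem exists_of_subcritical (n : ℕ) (hn : 2 ≤ n) (q s : ℝ) (hq : 1 < q) (hs : 0 < s)
    (hs1 : s < 1) (hgap : 0 < 2 * (1 + s) / (q - 1) + 2 - n) :
    ∃ P : Params, P.n = n ∧ P.q = q ∧ P.s = s := by
  have hn' : (0 : ℝ) < n := by exact_mod_cast (by omega : 0 < n)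
  set d := 2 * (1 + s) / (q - 1) + 2 - n with hd
  have hc : 0 < 2 / (q - 1) + 2 := by
    have : 0 < q - 1 := by linarith
    positivity
  set σ := min s (d / 4 / (2 / (q - 1) + 2)) with hσ
  have hσ0 : 0 < σ := lt_min hs (by positivity)
  have hσs : σ ≤ s := min_le_left _ _
  -- This ε turns `ε_small` into an equality; σ ≤ s < 1 reduces `σ_small` to a linear condition on
  -- σ.
  refine ⟨⟨n, q, s, σ, d / (8 * n), hn, hq, hs, hs1, hσ0, hσs, by positivity, hgap, ?_, ?_⟩,
    rfl, rfl, rfl⟩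
  · have h1 : σ * (2 / (q - 1) + 2) ≤ d / 4 := (le_div_iff₀ hc).1 (min_le_right _ _)
    have h2 : σ ^ 2 ≤ σ := by nlinarith
    calc 2 * σ / (q - 1) + 2 * σ ^ 2 ≤ 2 * σ / (q - 1) + 2 * σ := by linarith
      _ = σ * (2 / (q - 1) + 2) := by ring
      _ ≤ d / 4 := h1
  · rw [← hd]
    refine le_of_eq ?_
    field_simp
    norm_num

end Params

end LaneEmden

end

theorem mainTheorem5 (n : ℕ) (hn : 2 ≤ n) (α q : ℝ) (hα : 1 < α)
    (hq : q ∈ Set.Ioo (LaneEmden.tildeTwo n α) (LaneEmden.twoStar n α - 1)) :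
    ∃ (ψ : ℝ → ℝ) (κ : ℝ) (g : LaneEmden.Metric n) (u : LaneEmden.Space n → ℝ),
      LaneEmden.IsModelFunction ψ ∧
      0 < κ ∧
      (deriv ψ ~[atTop] fun r : ℝ => κ * α * r ^ (α - 1)) ∧
      LaneEmden.IsModelMetric g ψ ∧
      LaneEmden.IsCartanHadamard g ∧
      LaneEmden.IsRadial u ∧
      LaneEmden.IsLaneEmdenSolution g q u ∧
      LaneEmden.MemD12Rad g u := by
  have hn' : (1 : ℝ) ≤ n - 1 := by
    have : (2 : ℝ) ≤ n := by exact_mod_cast hn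
    linarith
  have hαn : 0 < α * (n - 1) - 1 := by nlinarith
  have hq1 : 2 < (q - 1) * (α * (n - 1) - 1) := by
    have h := hq.1
    rw [LaneEmden.tildeTwo, div_lt_iff₀ hαn] at h
    linarith
  have hq2 : (q - 1) * (α * (n - 1) - 1) < 4 := by
    have h := hq.2
    rw [LaneEmden.twoStar, lt_sub_iff_add_lt, lt_div_iff₀ hαn] at h
    linarith
  have hq0 : 0 < q - 1 := by
    by_contra! h
    nlinarith
  have hN : 2 * (1 + ((q - 1) * (α * (n - 1) - 1) - 2) / 2) / (q - 1) = α * (n - 1) - 1 := by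
    field_simp
    ring
  -- s is forced by 2(1+s)/(q-1) = α(n-1) - 1, which makes the gap (n-1)(α-1) > 0. The lower bound
  -- on q is s > 0 and the upper bound is s < 1.
  obtain ⟨P, rfl, rfl, hs⟩ := LaneEmden.Params.exists_of_subcritical n hn q
    (((q - 1) * (α * (n - 1) - 1) - 2) / 2) (by linarith) (by linarith) (by linarith)
    (by rw [hN]; nlinarith)
  have hgap : P.gap / (P.n - 1) = α - 1 := by
    rw [LaneEmden.Params.gap, hs, hN]
    field_simp
    ring
  obtain ⟨κ, hκ, hequiv⟩ := P.exists_isEquivalent_deriv_model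
  rw [hgap, sub_add_cancel] at hequiv
  have hU : ContDiff ℝ 2 P.U := by exact_mod_cast contDiff_infty.1 P.contDiff_U 2
  refine ⟨P.profile.model, κ, P.profile.metric, fun x => P.U (‖x‖ ^ 2),
    P.profile.isModelFunction_model, hκ, hequiv, P.profile.isModelMetric_metric,
    P.profile.isCartanHadamard (fun t ht => P.deriv_Λ_nonneg ht) (fun t ht => P.convexity ht),
    ⟨fun s => P.U (s ^ 2), fun _ => rfl⟩,
    ⟨hU.comp (contDiff_norm_sq ℝ), fun x => P.U_pos _, fun x => ?_⟩, ?_⟩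
  · rw [P.profile.laplaceBeltrami_radial (by omega) hU]
    exact P.ode (sq_nonneg _)
  · refine P.profile.memD12Rad (by omega) (P.contDiff_U.of_le (by simp)) (fun t _ => P.U_pos t)
      P.tendsto_U (r := P.n + 2 * (1 + P.s) / (P.q - 1)) ?_ (fun t ht => P.energy_bound ht)
    have : 0 < 2 * (1 + P.s) / (P.q - 1) := div_pos (by linarith [P.s_pos]) hq0
    linarith
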